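/- Let $\mathbb T=\mathbb R/\mathbb Z$, let $G$ be the Heisenberg group of real matrices $\begin{pmatrix}1&a&c\\0&1&b\\0&0&1\end{pmatrix}$, let $\Gamma\subset G$ be the subgroup of integer matrices, and let $\Gamma\backslash G$ be the compact space of cosets $\Gamma g$. For real $r>1$, a continuous function $f:\mathbb R\to\mathbb R$ of period $1$ is called $C^r$-smooth if its Fourier coefficients satisfy $\widehat f(n)=O(|n|^{-r})$ for $n\neq 0$. For a homeomorphism $T$ of a compact space $X$ let $M(X,T)$ be the set of $T$-invariant Borel probability measures. For $\nu\in M(X,T)$, the system $(X,T,\nu)$ has *polynomial rate of rigidity* if there is a set $\mathcal F\subset C(X)$ of continuous complex-valued functions, whose linear span is dense in $C(X)$, such that for every $f\in\mathcal F$ there are $\delta>0$ and a strictly increasing sequence $(r_n)$ of positive integers with $$\sum_{|j|\le r_n^{\delta}}\|f\circ T^{jr_n}-f\|_{L^2(\nu)}^2\longrightarrow 0\qquad(n\to\infty).\tag{1}$$ **Theorem 1.1.** Let $\alpha\in[0,1)$ be irrational and $0<\varepsilon<10^{-2}$. Let $\varphi,\eta,\psi:\mathbb R\to\mathbb R$ be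 continuous functions of period $1$ such that $\psi$ is $C^{1+\varepsilon}$-smooth, $\varphi$ and $\eta$ are $C^{2+2\varepsilon}$-smooth, and $\int_0^1\varphi(t)\,dt=\int_0^1\eta(t)\,dt=0$ (it is not assumed that $\varphi=\eta$). Let $S_\alpha$ be the homeomorphism of $\mathbb T\times\Gamma\backslash G$ given by $$S_\alpha(t,\Gamma g)=\left(t+\alpha,\ \Gamma g\begin{pmatrix}1&\varphi(t)&\psi(t)\\0&1&\eta(t)\\0&0&1\end{pmatrix}\right).$$ Then $(\mathbb T\times\Gamma\backslash G,S_\alpha,\nu)$ has polynomial rate of rigidity for every $\nu\in M(\mathbb T\times\Gamma\backslash G,S_\alpha)$. Moreover, let $q_0=1,q_1,q_2,\dots$ be the denominators of the continued-fraction convergents of $\alpha$. The rigidity times can be taken to be multiples of these: there are indices $m_1<m_2<\cdots$ and integers $v_n$ with $1\le v_n\le q_{m_n}^{\varepsilon/16}$ such that $r_n=v_nq_{m_n}$ is strictly increasing and, for every $\nu\in M(\mathbb T\times\Gamma\backslash G,S_\alpha)$, there is a set $\mathcal F$ with dense linear span in $C(\mathbb T\times\Gamma\backslash G)$ such that every $f\in\mathcal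 F$ satisfies (1), with $T=S_\alpha$, for this sequence $(r_n)$ and some $\delta>0$. -/

import Mathlib

open Filter Topology MeasureTheory

/-! ### The Heisenberg group -/

/-- The real Heisenberg group: `⟨a, c, b⟩` is the upper triangular matrix
`!![1, a, c; 0, 1, b; 0, 0, 1]` (see `Heis.toMatrix`, `Heis.toMatrix_mul`). -/
@[ext]
structure Heis where
  /-- the entry in row 1, column 2 -/
  a : ℝ
  /-- the entry in row 1, column 3 -/
  c : ℝ
  /-- the entry in row 2, column 3 -/
  b : ℝ

namespace Heis

/-- The matrix of an element of the Heisenberg group. -/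
def toMatrix (g : Heis) : Matrix (Fin 3) (Fin 3) ℝ :=
  !![1, g.a, g.c; 0, 1, g.b; 0, 0, 1]

instance : Mul Heis := ⟨fun g h => ⟨g.a + h.a, g.c + h.c + g.a * h.b, g.b + h.b⟩⟩
instance : One Heis := ⟨⟨0, 0, 0⟩⟩
instance : Inv Heis := ⟨fun g => ⟨-g.a, g.a * g.b - g.c, -g.b⟩⟩

@[simp] theorem mul_a (g h : Heis) : (g * h).a = g.a + h.a := rfl
@[simp] theorem mul_c (g h : Heis) : (g * h).c = g.c + h.c + g.a * h.b := rfl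
@[simp] theorem mul_b (g h : Heis) : (g * h).b = g.b + h.b := rfl
@[simp] theorem one_a : (1 : Heis).a = 0 := rfl
@[simp] theorem one_c : (1 : Heis).c = 0 := rfl
@[simp] theorem one_b : (1 : Heis).b = 0 := rfl
@[simp] theorem inv_a (g : Heis) : (g⁻¹).a = -g.a := rfl
@[simp] theorem inv_c (g : Heis) : (g⁻¹).c = g.a * g.b - g.c := rfl
@[simp] theorem inv_b (g : Heis) : (g⁻¹).b = -g.b := rfl

/-- The group law is matrix multiplication. -/
theorem toMatrix_mul (g h : Heis) : (g * h).toMatrix = g.toMatrix * h.toMatrix := by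
  ext i j
  fin_cases i <;> fin_cases j <;>
    simp [toMatrix, Matrix.mul_apply, Fin.sum_univ_three] <;> ring

theorem toMatrix_injective : Function.Injective toMatrix := by
  intro g h e
  ext
  · exact congrFun (congrFun e 0) 1
  · exact congrFun (congrFun e 0) 2
  · exact congrFun (congrFun e 1) 2

instance : Group Heis :=
  Group.ofLeftAxioms
    (fun g h k => by ext <;> simp <;> ring)
    (fun g => by ext <;> simp)
    (fun g => by ext <;> simp)

/-- The topology of a subspace of the space of real `3 × 3` matrices. -/
instance : TopologicalSpace Heis := TopologicalSpace.induced toMatrix inferInstance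

theorem continuous_a : Continuous Heis.a :=
  (continuous_induced_dom (f := toMatrix)).matrix_elem 0 1
theorem continuous_c : Continuous Heis.c :=
  (continuous_induced_dom (f := toMatrix)).matrix_elem 0 2
theorem continuous_b : Continuous Heis.b :=
  (continuous_induced_dom (f := toMatrix)).matrix_elem 1 2

theorem continuous_mk {Y : Type*} [TopologicalSpace Y] {u v w : Y → ℝ}
    (hu : Continuous u) (hv : Continuous v) (hw : Continuous w) :
    Continuous (fun y => (⟨u y, v y, w y⟩ : Heis)) := by
  refine continuous_induced_rng.2 (continuous_matrix fun i j => ?_)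
  fin_cases i <;> fin_cases j <;> simpa [toMatrix] using by fun_prop

instance : ContinuousMul Heis :=
  ⟨continuous_mk
    ((continuous_a.comp continuous_fst).add (continuous_a.comp continuous_snd))
    (((continuous_c.comp continuous_fst).add (continuous_c.comp continuous_snd)).add
      ((continuous_a.comp continuous_fst).mul (continuous_b.comp continuous_snd)))
    ((continuous_b.comp continuous_fst).add (continuous_b.comp continuous_snd))⟩

instance : ContinuousInv Heis :=
  ⟨continuous_mk continuous_a.neg ((continuous_a.mul continuous_b).sub continuous_c)
    continuous_b.neg⟩

instance : SecondCountableTopology Heis :=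
  haveI : SecondCountableTopology (Matrix (Fin 3) (Fin 3) ℝ) :=
    inferInstanceAs (SecondCountableTopology (Fin 3 → Fin 3 → ℝ))
  (Topology.IsInducing.mk rfl : Topology.IsInducing toMatrix).secondCountableTopology

/-- The lattice of integer matrices in the Heisenberg group. -/
def lattice : Subgroup Heis where
  carrier := {g | ∃ k m l : ℤ, g = ⟨k, m, l⟩}
  one_mem' := ⟨0, 0, 0, by ext <;> simp⟩
  mul_mem' := by
    rintro _ _ ⟨k, m, l, rfl⟩ ⟨k', m', l', rfl⟩
    exact ⟨k + k', m + m' + k * l', l + l', by ext <;> simp⟩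
  inv_mem' := by
    rintro _ ⟨k, m, l, rfl⟩
    exact ⟨-k, k * l - m, -l, by ext <;> simp⟩

end Heis

/-! ### The Heisenberg nilmanifold -/

/-- The nilmanifold `Γ \ G` of right cosets `Γ g`, with the quotient topology. -/
abbrev HeisNil : Type := Quotient (QuotientGroup.rightRel Heis.lattice)

namespace HeisNil

/-- The coset `Γ g`. -/
def mk (g : Heis) : HeisNil := Quotient.mk _ g

theorem isOpenQuotientMap_mk : IsOpenQuotientMap mk :=
  ⟨Quot.mk_surjective, continuous_quot_mk,
    isOpenMap_quotient_mk'_mul (Γ := Heis.lattice) (T := Heis)⟩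

/-- Right translation `(Γ g, h) ↦ Γ g h`. -/
def rmul (x : HeisNil) (h : Heis) : HeisNil :=
  Quotient.map (fun g => g * h) (fun g g' e => by
    rw [← Quotient.eq_iff_equiv, Quotient.eq, QuotientGroup.rightRel_apply] at e ⊢
    simpa [mul_assoc] using e) x

@[simp] theorem rmul_mk (g h : Heis) : rmul (mk g) h = mk (g * h) := rfl

theorem rmul_rmul (x : HeisNil) (g h : Heis) : rmul (rmul x g) h = rmul x (g * h) := by
  obtain ⟨k, rfl⟩ := isOpenQuotientMap_mk.surjective x
  simp [mul_assoc]

theorem rmul_one (x : HeisNil) : rmul x 1 = x := by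
  obtain ⟨k, rfl⟩ := isOpenQuotientMap_mk.surjective x
  simp

theorem continuous_rmul : Continuous (fun p : HeisNil × Heis => rmul p.1 p.2) := by
  have h := (isOpenQuotientMap_mk.prodMap (IsOpenQuotientMap.id (X := Heis)))
  rw [← h.continuous_comp_iff]
  exact isOpenQuotientMap_mk.continuous.comp continuous_mul

instance : SecondCountableTopology HeisNil :=
  TopologicalSpace.Quotient.secondCountableTopology isOpenQuotientMap_mk.isOpenMap

instance : CompactSpace HeisNil := by
  have hc : Continuous (fun p : ℝ × ℝ × ℝ => mk ⟨p.1, p.2.1, p.2.2⟩) :=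
    isOpenQuotientMap_mk.continuous.comp
      (Heis.continuous_mk (by fun_prop) (by fun_prop) (by fun_prop))
  have hK : IsCompact (Set.Icc (0 : ℝ) 1 ×ˢ Set.Icc (0 : ℝ) 1 ×ˢ Set.Icc (0 : ℝ) 1) :=
    isCompact_Icc.prod (isCompact_Icc.prod isCompact_Icc)
  refine ⟨(hK.image hc).of_isClosed_subset isClosed_univ fun x _ => ?_⟩
  obtain ⟨g, rfl⟩ := isOpenQuotientMap_mk.surjective x
  refine ⟨(Int.fract g.a, Int.fract (g.c - ⌊g.a⌋ * g.b), Int.fract g.b),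
    ⟨⟨Int.fract_nonneg _, (Int.fract_lt_one _).le⟩,
      ⟨Int.fract_nonneg _, (Int.fract_lt_one _).le⟩,
      ⟨Int.fract_nonneg _, (Int.fract_lt_one _).le⟩⟩, ?_⟩
  refine Quotient.sound ?_
  rw [← Quotient.eq_iff_equiv, Quotient.eq, QuotientGroup.rightRel_apply]
  refine ⟨⌊g.a⌋, ⌊g.c - ⌊g.a⌋ * g.b⌋ + ⌊g.a⌋ * ⌊g.b⌋, ⌊g.b⌋, ?_⟩
  rw [mul_inv_eq_iff_eq_mul]
  ext
  · simp
  · simp only [Heis.mul_c, Int.fract, Int.cast_add, Int.cast_mul]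
    ring
  · simp

/-- The nilmanifold carries its Borel `σ`-algebra. -/
instance : MeasurableSpace HeisNil := borel _
instance : BorelSpace HeisNil := ⟨rfl⟩

end HeisNil

/-- The phase space `𝕋 × Γ \ G`, with `𝕋 = ℝ / ℤ`. -/
abbrev CircleHeis : Type := UnitAddCircle × HeisNil

/-- The product `σ`-algebra on the phase space is its Borel `σ`-algebra. -/
theorem borelSpace_circleHeis : BorelSpace CircleHeis := inferInstance

/-! ### Periodic functions and their smoothness -/

/-- `f` is a continuous `1`-periodic real function of class `C^r`, where (as usual in this
context, for real `r > 1`) `C^r`-smoothness is expressed by the decay `O(|n|^{-r})` of the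
Fourier coefficients. -/
structure IsSmoothPeriodic (r : ℝ) (f : ℝ → ℝ) : Prop where
  periodic : Function.Periodic f 1
  continuous : Continuous f
  decay : ∃ C : ℝ, ∀ n : ℤ, n ≠ 0 →
    ‖fourierCoeffOn (zero_lt_one' ℝ) (fun t => (f t : ℂ)) n‖ ≤ C * |(n : ℝ)| ^ (-r)

/-- The function on the circle `ℝ / ℤ` induced by a continuous `1`-periodic function. -/
def circleFun (f : ℝ → ℝ) (hp : Function.Periodic f 1) (hc : Continuous f) :
    C(UnitAddCircle, ℝ) where
  toFun := hp.lift
  continuous_toFun := continuous_coinduced_dom.2 hc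

@[simp] theorem circleFun_coe (f : ℝ → ℝ) (hp : Function.Periodic f 1) (hc : Continuous f)
    (t : ℝ) : circleFun f hp hc (t : UnitAddCircle) = f t := rfl

/-! ### The skew product -/

/-- The fibre element `!![1, φ t, ψ t; 0, 1, η t; 0, 0, 1]`. -/
def cocycle (φ η ψ : C(UnitAddCircle, ℝ)) (t : UnitAddCircle) : Heis := ⟨φ t, ψ t, η t⟩

theorem continuous_cocycle (φ η ψ : C(UnitAddCircle, ℝ)) : Continuous (cocycle φ η ψ) :=
  Heis.continuous_mk φ.continuous ψ.continuous η.continuous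

/-- The skew product `S_α : (t, Γ g) ↦ (t + α, Γ g !![1, φ t, ψ t; 0, 1, η t; 0, 0, 1])`,
as a homeomorphism of `𝕋 × Γ \ G`. -/
def skewProduct (α : ℝ) (φ η ψ : C(UnitAddCircle, ℝ)) : CircleHeis ≃ₜ CircleHeis where
  toFun p := (p.1 + (α : UnitAddCircle), HeisNil.rmul p.2 (cocycle φ η ψ p.1))
  invFun p := (p.1 - (α : UnitAddCircle),
    HeisNil.rmul p.2 (cocycle φ η ψ (p.1 - (α : UnitAddCircle)))⁻¹)
  left_inv p := by simp [HeisNil.rmul_rmul, HeisNil.rmul_one]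
  right_inv p := by simp [HeisNil.rmul_rmul, HeisNil.rmul_one]
  continuous_toFun := (continuous_fst.add continuous_const).prodMk
    (HeisNil.continuous_rmul.comp
      (continuous_snd.prodMk ((continuous_cocycle φ η ψ).comp continuous_fst)))
  continuous_invFun := (continuous_fst.sub continuous_const).prodMk
    (HeisNil.continuous_rmul.comp
      (continuous_snd.prodMk
        ((continuous_cocycle φ η ψ).comp (continuous_fst.sub continuous_const)).inv))

/-! ### Polynomial rate of rigidity -/

section Rigidity

variable {X : Type*} [TopologicalSpace X] [CompactSpace X] [MeasurableSpace X] [BorelSpace X]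

/-- `ν` is a `T`-invariant Borel probability measure. -/
def IsInvariantProb (T : X ≃ₜ X) (ν : Measure X) : Prop :=
  IsProbabilityMeasure ν ∧ MeasurePreserving T ν ν

/-- `∑_{|j| ≤ r_n^δ} ‖f ∘ T^{j r_n} - f‖²_{L²(ν)} → 0` as `n → ∞`. -/
def RigidityRate (T : X ≃ₜ X) (ν : Measure X) (f : C(X, ℂ)) (δ : ℝ) (r : ℕ → ℕ) : Prop :=
  Tendsto (fun n => ∑ j ∈ Finset.Icc (-⌊(r n : ℝ) ^ δ⌋) ⌊(r n : ℝ) ^ δ⌋,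
    ∫ x, ‖f ((T ^ (j * (r n : ℤ))) x) - f x‖ ^ 2 ∂ν) atTop (𝓝 0)

/-- `F` is linearly dense in `C(X)` (with the supremum norm, `X` being compact). -/
def IsLinearlyDense (F : Set C(X, ℂ)) : Prop :=
  Dense (Submodule.span ℂ F : Set C(X, ℂ))

/-- Polynomial rate of rigidity of `(X, T, ν)`. -/
def HasPRRigidity (T : X ≃ₜ X) (ν : Measure X) : Prop :=
  ∃ F : Set C(X, ℂ), IsLinearlyDense F ∧ ∀ f ∈ F, ∃ δ : ℝ, 0 < δ ∧
    ∃ r : ℕ → ℕ, StrictMono r ∧ (∀ n, 0 < r n) ∧ RigidityRate T ν f δ r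

/-- Polynomial rate of rigidity of `(X, T, ν)` with the prescribed rigidity times `r`, the same
for all functions in the linearly dense family. -/
def HasPRRigidityAlong (T : X ≃ₜ X) (ν : Measure X) (r : ℕ → ℕ) : Prop :=
  ∃ F : Set C(X, ℂ), IsLinearlyDense F ∧ ∀ f ∈ F, ∃ δ : ℝ, 0 < δ ∧
    RigidityRate T ν f δ r

end Rigidity

/-! ### Exponential sums over a rotation -/

/-! The iterate `S ^ q` rotates the base by `q α` and multiplies the fibre on the right by the
matrix whose off-diagonal entries are the Birkhoff sums of `φ` and `η` and whose corner is the
Birkhoff sum of `ψ` plus the double sum of `φ (t + i α) η (t + j α)` over `i < j < q`. The core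
claim is that for infinitely many convergent denominators `q` the first two are `O(q ^ (-ε/5))`
uniformly in `t`, and the corner is within `O(q ^ (-ε/5))` of a constant `β`
(`exists_cocycle_bound`).

Expand in Fourier series. Frequencies above `q / 2` are handled by spacing: multiples of `α` by
integers in a short block are `1 / (2 q)`-separated (`tail_sum_le`). Frequencies up to `q / 2` gain
from `‖q α‖ ≤ 1 / Q`, with `Q` the next denominator (`expFn_sum_le`). In the double sum the pairs `k
+ l = 0` do not depend on `t` and form part of `β`; for the others the small divisor is taken at the
smaller of the two frequencies, so that the decay at the larger one controls the frequency `k + l`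
(`doubleGeom_weighted_le`).

What remains is a pair of small divisor bounds, `HeadBound`. They hold infinitely often by a
dichotomy (`frequently_headBound`): either `Q ≥ q ^ (2 + ε)` infinitely often and crude bounds
suffice, or `α` is Diophantine with exponent `2 + ε` and the weighted small divisor sum converges.

The constant `β` need not be near an integer, but Dirichlet gives `v ≤ q ^ (ε/16)` with `v β` close
to an integer (`exists_multiplier`), and integral central elements act trivially on the nilmanifold.
Hence `S ^ (j v q)` is uniformly close to the identity for all `j ≤ q ^ (ε/64)`
(`norm_iterate_sub_le`). Functions that are Lipschitz for a homogeneous gauge form a dense algebra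
by Stone–Weierstrass, and for them the bound is uniform in the point, so it holds in `L²(ν)` for
every `ν` along the same times. -/

theorem UnitAddCircle.exists_rep (y : UnitAddCircle) :
    ∃ t : ℝ, (t : UnitAddCircle) = y ∧ |t| = ‖y‖ ∧ |t| ≤ 1 / 2 := by
  obtain ⟨s, rfl⟩ := QuotientAddGroup.mk_surjective y
  refine ⟨s - round s, ?_, ?_, abs_sub_round s⟩
  · have : ((round s : ℝ) : UnitAddCircle) = 0 := by
      have := AddCircle.coe_eq_zero_iff (p := (1:ℝ)) (x := (round s : ℝ))
      rw [this]; exact ⟨round s, by simp⟩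
    rw [AddCircle.coe_sub, this, sub_zero]
  · exact (UnitAddCircle.norm_eq (x := s)).symm

theorem norm_toCircle_sub_one (t : ℝ) :
    ‖((AddCircle.toCircle (t : UnitAddCircle) : Circle) : ℂ) - 1‖ = 2 * |Real.sin (Real.pi * t)| := by
  have : ((AddCircle.toCircle (t : UnitAddCircle) : Circle) : ℂ)
      = Complex.exp (Complex.I * ((2 * Real.pi * t : ℝ) : ℂ)) := by
    rw [AddCircle.toCircle_apply_mk, Circle.coe_exp]
    congr 1
    push_cast
    ring
  rw [this, Complex.norm_exp_I_mul_ofReal_sub_one, Real.norm_eq_abs, abs_mul, abs_two]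
  congr 3
  ring

theorem four_mul_norm_le_norm_toCircle_sub_one (y : UnitAddCircle) :
    4 * ‖y‖ ≤ ‖((AddCircle.toCircle y : Circle) : ℂ) - 1‖ := by
  obtain ⟨t, rfl, ht, ht2⟩ := UnitAddCircle.exists_rep y
  rw [norm_toCircle_sub_one, ← ht]
  have h := Real.mul_abs_le_abs_sin (x := Real.pi * t) (by
    rw [abs_mul, abs_of_pos Real.pi_pos]; nlinarith [Real.pi_pos])
  rw [abs_mul, abs_of_pos Real.pi_pos] at h
  have : 2 / Real.pi * (Real.pi * |t|) = 2 * |t| := by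
    field_simp
  linarith

theorem norm_toCircle_sub_one_le (y : UnitAddCircle) :
    ‖((AddCircle.toCircle y : Circle) : ℂ) - 1‖ ≤ 8 * ‖y‖ := by
  obtain ⟨t, rfl, ht, ht2⟩ := UnitAddCircle.exists_rep y
  rw [norm_toCircle_sub_one, ← ht]
  have h := Real.abs_sin_le_abs (x := Real.pi * t)
  rw [abs_mul, abs_of_pos Real.pi_pos] at h
  nlinarith [Real.pi_lt_four, abs_nonneg t]

/-- The iterated geometric sum `∑_{i < j < q} u ^ i * w ^ j`. -/
noncomputable def doubleGeom (u w : ℂ) (q : ℕ) : ℂ :=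
  ∑ j ∈ Finset.range q, (∑ i ∈ Finset.range j, u ^ i) * w ^ j

/-- The inner geometric sum telescopes. With the companion identity for `w - 1`, either frequency
can serve as the small divisor, leaving only simple sums. -/
theorem sub_one_mul_doubleGeom_left (u w : ℂ) (q : ℕ) :
    (u - 1) * doubleGeom u w q =
      (∑ j ∈ Finset.range q, (u * w) ^ j) - ∑ j ∈ Finset.range q, w ^ j := by
  rw [doubleGeom, Finset.mul_sum, ← Finset.sum_sub_distrib]
  refine Finset.sum_congr rfl fun j _ => ?_
  rw [← mul_assoc, mul_comm (u - 1), geom_sum_mul, mul_pow]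
  ring

/-- Summation by parts in the outer index. -/
theorem sub_one_mul_doubleGeom_right (u w : ℂ) (q : ℕ) :
    (w - 1) * doubleGeom u w q =
      w ^ q * (∑ j ∈ Finset.range q, u ^ j) - w * ∑ j ∈ Finset.range q, (u * w) ^ j := by
  induction q with
  | zero => simp [doubleGeom]
  | succ q ih =>
    have : doubleGeom u w (q + 1) = doubleGeom u w q + (∑ i ∈ Finset.range q, u ^ i) * w ^ q :=
      Finset.sum_range_succ _ _
    rw [this, mul_add, ih, Finset.sum_range_succ, Finset.sum_range_succ, mul_pow]
    ring

theorem norm_geom_sum_le {u : ℂ} (hu : ‖u‖ = 1) (q : ℕ) :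
    ‖∑ j ∈ Finset.range q, u ^ j‖ ≤ q := by
  refine (norm_sum_le _ _).trans ?_
  simp [hu]

theorem norm_sub_one_mul_norm_geom_sum (u : ℂ) (q : ℕ) :
    ‖u - 1‖ * ‖∑ j ∈ Finset.range q, u ^ j‖ = ‖u ^ q - 1‖ := by
  rw [← norm_mul, mul_comm, geom_sum_mul]

theorem norm_doubleGeom_le {u w : ℂ} (hu : ‖u‖ = 1) (hw : ‖w‖ = 1) (q : ℕ) :
    ‖doubleGeom u w q‖ ≤ q * q := by
  refine (norm_sum_le _ _).trans ?_
  calc _ ≤ ∑ j ∈ Finset.range q, (q : ℝ) := Finset.sum_le_sum fun j hj => by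
        rw [norm_mul, norm_pow, hw, one_pow, mul_one]
        refine (norm_geom_sum_le hu j).trans ?_
        exact_mod_cast (Finset.mem_range.1 hj).le
    _ = q * q := by simp

theorem norm_mul_norm_doubleGeom_left (u w : ℂ) (q : ℕ) :
    ‖u - 1‖ * ‖doubleGeom u w q‖ ≤
      ‖∑ j ∈ Finset.range q, (u * w) ^ j‖ + ‖∑ j ∈ Finset.range q, w ^ j‖ := by
  rw [← norm_mul, sub_one_mul_doubleGeom_left]
  exact norm_sub_le _ _

theorem norm_mul_norm_doubleGeom_right (u : ℂ) {w : ℂ} (hw : ‖w‖ = 1) (q : ℕ) :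
    ‖w - 1‖ * ‖doubleGeom u w q‖ ≤
      ‖∑ j ∈ Finset.range q, (u * w) ^ j‖ + ‖∑ j ∈ Finset.range q, u ^ j‖ := by
  rw [← norm_mul, sub_one_mul_doubleGeom_right]
  refine (norm_sub_le _ _).trans ?_
  rw [norm_mul, norm_mul, norm_pow, hw, one_pow, one_mul, one_mul, add_comm]

/-- The exponential sum `∑_{j < q} e(n j x)`. -/
noncomputable def expSum (x : UnitAddCircle) (q : ℕ) (n : ℤ) : ℂ :=
  ∑ j ∈ Finset.range q, (fourier n x : ℂ) ^ j

theorem norm_fourier_eq_one (n : ℤ) (x : UnitAddCircle) : ‖(fourier n x : ℂ)‖ = 1 := by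
  rw [fourier_apply]; exact Circle.norm_coe _

theorem four_mul_norm_zsmul_le (n : ℤ) (x : UnitAddCircle) :
    4 * ‖n • x‖ ≤ ‖(fourier n x : ℂ) - 1‖ := by
  rw [fourier_apply]; exact four_mul_norm_le_norm_toCircle_sub_one _

/-- The majorant `min (q, 1 / ‖n x‖)` of exponential sums (equal to `q` if `n x = 0`). -/
noncomputable def majorant (x : UnitAddCircle) (q : ℕ) (n : ℤ) : ℝ :=
  if n • x = 0 then q else min (q : ℝ) (1 / ‖n • x‖)

theorem majorant_nonneg (x : UnitAddCircle) (q : ℕ) (n : ℤ) : 0 ≤ majorant x q n := by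
  unfold majorant; split_ifs <;> positivity

theorem majorant_le (x : UnitAddCircle) (q : ℕ) (n : ℤ) : majorant x q n ≤ q := by
  unfold majorant; split_ifs
  · exact le_rfl
  · exact min_le_left _ _

theorem le_majorant {x : UnitAddCircle} {q : ℕ} {n : ℤ} {B : ℝ} (h1 : B ≤ q)
    (h2 : ‖n • x‖ * B ≤ 1) : B ≤ majorant x q n := by
  unfold majorant; split_ifs with h
  · exact h1
  · refine le_min h1 ?_
    rw [le_div_iff₀ (norm_pos_iff.2 h), mul_comm]; exact h2

theorem majorant_neg (x : UnitAddCircle) (q : ℕ) (n : ℤ) : majorant x q (-n) = majorant x q n := by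
  simp [majorant]

theorem norm_expSum_le_majorant (x : UnitAddCircle) (q : ℕ) (n : ℤ) :
    ‖expSum x q n‖ ≤ majorant x q n := by
  have hu := norm_fourier_eq_one n x
  refine le_majorant (norm_geom_sum_le hu q) ?_
  have h := norm_sub_one_mul_norm_geom_sum (fourier n x : ℂ) q
  have h2 : ‖(fourier n x : ℂ) ^ q - 1‖ ≤ 2 := by
    refine (norm_sub_le _ _).trans ?_
    rw [norm_pow, hu]; norm_num
  have h3 := four_mul_norm_zsmul_le n x
  have h0 : 0 ≤ ‖expSum x q n‖ := norm_nonneg _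
  rw [← expSum] at h
  nlinarith [norm_nonneg (n • x)]

/-- In the closed form of the geometric sum the numerator `e(n q x) - 1` is at most `8 |n| / Q` and
the denominator at least `4 ‖n x‖`. -/
theorem norm_expSum_le_of_norm_nsmul_le {x : UnitAddCircle} {q : ℕ} {n : ℤ} {Q : ℝ} (hQ : 0 < Q)
    (h : ‖q • x‖ ≤ 1 / Q) (hn : n • x ≠ 0) :
    ‖expSum x q n‖ ≤ 2 * |(n : ℝ)| / (Q * ‖n • x‖) := by
  have h1 := norm_sub_one_mul_norm_geom_sum (fourier n x : ℂ) q
  rw [← expSum] at h1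
  have h3 := four_mul_norm_zsmul_le n x
  have h2 : ‖(fourier n x : ℂ) ^ q - 1‖ ≤ 8 * (|(n : ℝ)| * (1 / Q)) := by
    have : (fourier n x : ℂ) ^ q = ((AddCircle.toCircle (n • (q • x)) : Circle) : ℂ) := by
      rw [fourier_apply, smul_comm, AddCircle.toCircle_nsmul, Circle.coe_pow]
    rw [this]
    refine (norm_toCircle_sub_one_le _).trans ?_
    have : ‖n • (q • x)‖ ≤ |(n : ℝ)| * ‖q • x‖ := by
      have := norm_zsmul_le n (q • x)
      simpa [Int.norm_eq_abs] using this
    have h5 : |(n : ℝ)| * ‖q • x‖ ≤ |(n : ℝ)| * (1 / Q) := by gcongr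
    linarith
  have hpos := norm_pos_iff.2 hn
  rw [le_div_iff₀ (by positivity)]
  have h4 : 4 * ‖n • x‖ * ‖expSum x q n‖ ≤ 8 * (|(n : ℝ)| * (1 / Q)) := by
    refine le_trans ?_ (h1.le.trans h2)
    gcongr
  have h6 : 8 * (|(n : ℝ)| * (1 / Q)) * Q = 8 * |(n : ℝ)| := by field_simp
  nlinarith

theorem expSum_add (x : UnitAddCircle) (q : ℕ) (k l : ℤ) :
    expSum x q (k + l) = ∑ j ∈ Finset.range q, ((fourier k x : ℂ) * fourier l x) ^ j := by
  simp only [expSum, fourier_add]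

theorem norm_zsmul_mul_norm_doubleGeom_left (x : UnitAddCircle) (q : ℕ) (k l : ℤ) :
    ‖k • x‖ * ‖doubleGeom (fourier k x) (fourier l x) q‖ ≤
      ‖expSum x q (k + l)‖ + ‖expSum x q l‖ := by
  have h := norm_mul_norm_doubleGeom_left (fourier k x : ℂ) (fourier l x) q
  rw [← expSum_add, ← expSum] at h
  refine le_trans ?_ h
  gcongr
  linarith [four_mul_norm_zsmul_le k x, norm_nonneg (k • x)]

theorem norm_zsmul_mul_norm_doubleGeom_right (x : UnitAddCircle) (q : ℕ) (k l : ℤ) :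
    ‖l • x‖ * ‖doubleGeom (fourier k x) (fourier l x) q‖ ≤
      ‖expSum x q (k + l)‖ + ‖expSum x q k‖ := by
  have h := norm_mul_norm_doubleGeom_right (fourier k x : ℂ) (norm_fourier_eq_one l x) q
  rw [← expSum_add, ← expSum] at h
  refine le_trans ?_ h
  gcongr
  linarith [four_mul_norm_zsmul_le l x, norm_nonneg (l • x)]

/-- Used when `k` is a high frequency: both simple sums left after dividing by `u - 1` are bounded
trivially by `q`. -/
theorem norm_doubleGeom_le_majorant_left (x : UnitAddCircle) (q : ℕ) (k l : ℤ) :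
    ‖doubleGeom (fourier k x) (fourier l x) q‖ ≤ q * majorant x q k := by
  rcases Nat.eq_zero_or_pos q with rfl | hq
  · simp [doubleGeom]
  have hq' : (0 : ℝ) < q := by exact_mod_cast hq
  rw [mul_comm, ← div_le_iff₀ hq']
  refine le_majorant ?_ ?_
  · rw [div_le_iff₀ hq']
    exact norm_doubleGeom_le (norm_fourier_eq_one k x) (norm_fourier_eq_one l x) q
  · rw [← mul_div_assoc, div_le_one hq']
    have h := norm_mul_norm_doubleGeom_left (fourier k x : ℂ) (fourier l x) q
    rw [← expSum_add, ← expSum] at h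
    have h1 := (norm_expSum_le_majorant x q (k + l)).trans (majorant_le _ _ _)
    have h2 := (norm_expSum_le_majorant x q l).trans (majorant_le _ _ _)
    have h3 := four_mul_norm_zsmul_le k x
    nlinarith [norm_nonneg (doubleGeom (fourier k x) (fourier l x) q)]

theorem norm_doubleGeom_le_majorant_right (x : UnitAddCircle) (q : ℕ) (k l : ℤ) :
    ‖doubleGeom (fourier k x) (fourier l x) q‖ ≤ q * majorant x q l := by
  rcases Nat.eq_zero_or_pos q with rfl | hq
  · simp [doubleGeom]
  have hq' : (0 : ℝ) < q := by exact_mod_cast hq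
  rw [mul_comm, ← div_le_iff₀ hq']
  refine le_majorant ?_ ?_
  · rw [div_le_iff₀ hq']
    exact norm_doubleGeom_le (norm_fourier_eq_one k x) (norm_fourier_eq_one l x) q
  · rw [← mul_div_assoc, div_le_one hq']
    have h := norm_mul_norm_doubleGeom_right (fourier k x : ℂ) (norm_fourier_eq_one l x) q
    rw [← expSum_add, ← expSum] at h
    have h1 := (norm_expSum_le_majorant x q (k + l)).trans (majorant_le _ _ _)
    have h2 := (norm_expSum_le_majorant x q k).trans (majorant_le _ _ _)
    have h3 := four_mul_norm_zsmul_le l x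
    nlinarith [norm_nonneg (doubleGeom (fourier k x) (fourier l x) q)]

/-! ### Sums over well separated orbits -/

theorem norm_coe_le_abs (t : ℝ) : ‖(t : UnitAddCircle)‖ ≤ |t| := by
  rw [UnitAddCircle.norm_eq]
  simpa using round_le t 0

theorem one_add_log_le {l y : ℝ} (hl : 0 < l) (hy : 1 ≤ y) :
    1 + Real.log y ≤ (1 + 1 / l) * y ^ l := by
  have h1 := Real.log_le_rpow_div (zero_le_one.trans hy) hl
  have h2 : 1 ≤ y ^ l := Real.one_le_rpow hy hl.le
  have : (1 + 1 / l) * y ^ l = y ^ l + y ^ l / l := by ring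
  linarith

/-- Each cell `[k δ, (k + 1) δ)` contains at most one `a i`. The cell `k = 0` costs `Z`, a cell `k ≥
1` costs at most `1 / (k δ)`, and the harmonic sum produces the logarithm. -/
theorem sum_le_of_injOn_floor {ι : Type*} (s : Finset ι) (f a : ι → ℝ) {Z δ : ℝ} (hZ : 0 ≤ Z)
    (hδ : 0 < δ) (hδ1 : δ ≤ 1) (ha : ∀ i ∈ s, 0 ≤ a i ∧ a i ≤ 1 / 2)
    (hf : ∀ i ∈ s, f i ≤ Z ∧ a i * f i ≤ 1)
    (hinj : Set.InjOn (fun i => ⌊a i / δ⌋₊) s) :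
    ∑ i ∈ s, f i ≤ Z + 1 / δ * (1 + Real.log (1 / δ)) := by
  classical
  set M : ℕ := ⌊1 / δ⌋₊ with hM
  set F : ℕ → ℝ := fun k => if k = 0 then Z else 1 / δ * (k : ℝ)⁻¹ with hF
  have hF0 : ∀ k, 0 ≤ F k := fun k => by simp only [hF]; split_ifs <;> positivity
  have hδ1' : 1 ≤ 1 / δ := (one_le_div hδ).2 hδ1
  have hM1 : 1 ≤ M := Nat.le_floor (by simpa using hδ1')
  calc ∑ i ∈ s, f i ≤ ∑ i ∈ s, F ⌊a i / δ⌋₊ := by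
        refine Finset.sum_le_sum fun i hi => ?_
        simp only [hF]
        split_ifs with h
        · exact (hf i hi).1
        · have hpos : (0 : ℝ) < (⌊a i / δ⌋₊ : ℝ) := by exact_mod_cast Nat.pos_of_ne_zero h
          have h1 : (⌊a i / δ⌋₊ : ℝ) ≤ a i / δ := Nat.floor_le (div_nonneg (ha i hi).1 hδ.le)
          rw [le_div_iff₀ hδ] at h1
          have h2 : 0 < (⌊a i / δ⌋₊ : ℝ) * δ := by positivity
          have h3 : f i ≤ 1 / a i := by
            rw [le_div_iff₀ (h2.trans_le h1), mul_comm]; exact (hf i hi).2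
          refine h3.trans ?_
          rw [one_div, one_div, ← mul_inv, mul_comm δ]
          exact inv_anti₀ h2 h1
    _ = ∑ k ∈ s.image (fun i => ⌊a i / δ⌋₊), F k := (Finset.sum_image hinj).symm
    _ ≤ ∑ k ∈ Finset.range (M + 1), F k := by
        refine Finset.sum_le_sum_of_subset_of_nonneg (fun k hk => ?_) fun k _ _ => hF0 k
        obtain ⟨i, hi, rfl⟩ := Finset.mem_image.1 hk
        rw [Finset.mem_range, Nat.lt_succ_iff]
        refine Nat.floor_le_floor ?_
        gcongr
        linarith [(ha i hi).2]
    _ = Z + 1 / δ * (harmonic M : ℝ) := by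
        rw [Finset.sum_range_succ', add_comm, harmonic]
        push_cast
        rw [Finset.mul_sum]
        congr 1
        refine Finset.sum_congr rfl fun k _ => ?_
        simp [hF]
    _ ≤ Z + 1 / δ * (1 + Real.log (1 / δ)) := by
        have h1 := harmonic_le_one_add_log M
        have h2 : Real.log M ≤ Real.log (1 / δ) :=
          Real.log_le_log (by exact_mod_cast hM1) (Nat.floor_le (by positivity))
        gcongr
        linarith

/-- Representatives in `[-1/2, 1/2]` of equal sign have absolute values at least `δ` apart, so they
occupy distinct cells. The two signs account for the factor 2. -/
theorem sum_le_of_separated (x : UnitAddCircle) (s : Finset ℤ) (f : ℤ → ℝ) {Z δ : ℝ} (hZ : 0 ≤ Z)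
    (hδ : 0 < δ) (hδ1 : δ ≤ 1) (hf : ∀ n ∈ s, f n ≤ Z ∧ ‖n • x‖ * f n ≤ 1)
    (hsep : ∀ m ∈ s, ∀ n ∈ s, m ≠ n → δ ≤ ‖(m - n) • x‖) :
    ∑ n ∈ s, f n ≤ 2 * Z + 2 / δ * (1 + Real.log (1 / δ)) := by
  classical
  choose y hy1 hy2 hy3 using fun n : ℤ => UnitAddCircle.exists_rep (n • x)
  have key : ∀ m ∈ s, ∀ n ∈ s, (0 ≤ y m ↔ 0 ≤ y n) →
      ⌊|y m| / δ⌋₊ = ⌊|y n| / δ⌋₊ → m = n := by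
    intro m hm n hn hs h
    by_contra hne
    have h1 := hsep m hm n hn hne
    have h2 : ‖(m - n) • x‖ ≤ |y m - y n| := by
      rw [sub_zsmul, ← sub_eq_add_neg, ← hy1 m, ← hy1 n, ← AddCircle.coe_sub]
      exact norm_coe_le_abs _
    have h3 : |y m - y n| = |(|y m| - |y n|)| := by
      by_cases hc : 0 ≤ y m
      · rw [abs_of_nonneg hc, abs_of_nonneg (hs.1 hc)]
      · have hc' : ¬ 0 ≤ y n := fun h => hc (hs.2 h)
        push Not at hc hc'
        rw [abs_of_neg hc, abs_of_neg hc', ← abs_neg]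
        congr 1; ring
    have a1 := Nat.floor_le (div_nonneg (abs_nonneg (y m)) hδ.le)
    have a2 := Nat.lt_floor_add_one (|y m| / δ)
    have b1 := Nat.floor_le (div_nonneg (abs_nonneg (y n)) hδ.le)
    have b2 := Nat.lt_floor_add_one (|y n| / δ)
    rw [h] at a1 a2
    have h4 : |(|y m| / δ - |y n| / δ)| < 1 := by rw [abs_lt]; constructor <;> linarith
    rw [← sub_div, abs_div, abs_of_pos hδ, div_lt_one hδ] at h4
    linarith
  have main : ∀ t ⊆ s, (∀ m ∈ t, ∀ n ∈ t, (0 ≤ y m ↔ 0 ≤ y n)) →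
      ∑ n ∈ t, f n ≤ Z + 1 / δ * (1 + Real.log (1 / δ)) := by
    intro t ht hsign
    refine sum_le_of_injOn_floor t f (fun n => |y n|) hZ hδ hδ1
      (fun n _ => ⟨abs_nonneg _, hy3 n⟩) (fun n hn => ?_) ?_
    · simp only [hy2]; exact hf n (ht hn)
    · intro m hm n hn h
      exact key m (ht hm) n (ht hn) (hsign m hm n hn) h
  rw [← Finset.sum_filter_add_sum_filter_not s (fun n => 0 ≤ y n)]
  have h1 := main (s.filter fun n => 0 ≤ y n) (Finset.filter_subset _ _)
    (fun m hm n hn => by simp [(Finset.mem_filter.1 hm).2, (Finset.mem_filter.1 hn).2])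
  have h2 := main (s.filter fun n => ¬ 0 ≤ y n) (Finset.filter_subset _ _)
    (fun m hm n hn => by simp [(Finset.mem_filter.1 hm).2, (Finset.mem_filter.1 hn).2])
  calc _ ≤ _ := add_le_add h1 h2
    _ = _ := by ring

theorem summable_int_of_even {f : ℤ → ℝ} (h0 : ∀ n, 0 ≤ f n) (heven : ∀ n, f (-n) = f n) {B : ℝ}
    (hB : ∀ M : ℕ, ∑ n ∈ Finset.range M, f n ≤ B) : Summable f ∧ ∑' n, f n ≤ 2 * B := by
  have hs : Summable (fun n : ℕ => f n) := summable_of_sum_range_le (fun n => h0 n) hB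
  have hle : ∑' n : ℕ, f n ≤ B := Real.tsum_le_of_sum_range_le (fun n => h0 n) hB
  have h1 := hs.hasSum
  have h2 : HasSum (fun n : ℕ => f (-n)) (∑' n : ℕ, f n) := by simpa [heven] using h1
  have h3 := HasSum.of_nat_of_neg h1 h2
  refine ⟨h3.summable, ?_⟩
  rw [h3.tsum_eq]
  linarith [h0 0]

/-- All `n x` with `0 < 2 |n| ≤ q` are at distance at least `1 / (2 q)` from `0`. -/
def WellSpaced (x : UnitAddCircle) (q : ℕ) : Prop :=
  ∀ n : ℤ, n ≠ 0 → 2 * |n| ≤ q → 1 / (2 * (q : ℝ)) ≤ ‖n • x‖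

/-- Integers in a block of length `q / 2 + 1` differ by at most `q / 2`, so their multiples of `x`
are `1 / (2 q)`-separated. The logarithm is absorbed into `q ^ l`. -/
theorem WellSpaced.sum_majorant_le {x : UnitAddCircle} {q : ℕ} (h : WellSpaced x q) (hq : 1 ≤ q)
    {l : ℝ} (hl : 0 < l) (a : ℤ) :
    ∑ n ∈ Finset.Ico a (a + ((q / 2 + 1 : ℕ) : ℤ)), majorant x q n ≤
      6 * (1 + 1 / l) * 2 ^ l * (q : ℝ) ^ (1 + l) := by
  have hq' : (1 : ℝ) ≤ q := by exact_mod_cast hq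
  have hδ : (0 : ℝ) < 1 / (2 * q) := by positivity
  have h1 := sum_le_of_separated x (Finset.Ico a (a + ((q / 2 + 1 : ℕ) : ℤ))) (majorant x q)
    (Z := q) (δ := 1 / (2 * q)) (by positivity) hδ
    (by rw [div_le_one (by positivity)]; linarith) (fun n _ => ⟨majorant_le _ _ _, ?_⟩) ?_
  · have h2 : 1 + Real.log (1 / (1 / (2 * (q : ℝ)))) ≤ (1 + 1 / l) * (2 * (q : ℝ)) ^ l := by
      rw [one_div_one_div]
      exact one_add_log_le hl (by linarith)
    have h3 : (1 : ℝ) ≤ 1 + Real.log (1 / (1 / (2 * (q : ℝ)))) := by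
      rw [one_div_one_div]
      linarith [Real.log_nonneg (x := 2 * (q : ℝ)) (by linarith)]
    have h4 : (2 : ℝ) / (1 / (2 * q)) = 4 * q := by field_simp; norm_num
    rw [h4] at h1
    calc _ ≤ _ := h1
      _ ≤ 6 * q * (1 + Real.log (1 / (1 / (2 * (q : ℝ))))) := by nlinarith
      _ ≤ 6 * q * ((1 + 1 / l) * (2 * (q : ℝ)) ^ l) := by gcongr
      _ = _ := by
        rw [Real.mul_rpow (by norm_num) (by positivity), Real.rpow_add (by positivity),
          Real.rpow_one]
        ring
  · unfold majorant
    split_ifs with h0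
    · simp [h0]
    · have := norm_pos_iff.2 h0
      calc ‖n • x‖ * min (q : ℝ) (1 / ‖n • x‖) ≤ ‖n • x‖ * (1 / ‖n • x‖) := by
            gcongr; exact min_le_right _ _
        _ = 1 := by field_simp
  · intro m hm n hn hne
    rw [Finset.mem_Ico] at hm hn
    refine h (m - n) (sub_ne_zero.2 hne) ?_
    have : |m - n| ≤ ((q / 2 : ℕ) : ℤ) := by
      rw [abs_le]; push_cast at hm hn ⊢; omega
    omega

/-- The function `n ↦ |n| ^ (-s) * majorant x q n`, restricted to `2 |n| > q`. -/
noncomputable def tailFn (x : UnitAddCircle) (q : ℕ) (s : ℝ) (n : ℤ) : ℝ :=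
  if (q : ℤ) < 2 * |n| then |(n : ℝ)| ^ (-s) * majorant x q n else 0

theorem tailFn_nonneg (x : UnitAddCircle) (q : ℕ) (s : ℝ) (n : ℤ) : 0 ≤ tailFn x q s n := by
  unfold tailFn
  have := majorant_nonneg x q n
  split_ifs <;> positivity

theorem summable_nat_rpow_neg {s : ℝ} (hs : 1 < s) : Summable fun n : ℕ => (n : ℝ) ^ (-s) :=
  Real.summable_nat_rpow.2 (by linarith)

/-- Cut the positive integers into blocks of length `L = q / 2 + 1`. Block `b` contributes at most a
constant times `(L b) ^ (-s) * q ^ (1 + l)`, and the sum over `b` converges because `s > 1`. -/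
theorem tail_sum_le {s l : ℝ} (hs : 1 < s) (hl : 0 < l) :
    ∃ C : ℝ, 0 < C ∧ ∀ (x : UnitAddCircle) (q : ℕ), 1 ≤ q → WellSpaced x q →
      Summable (tailFn x q s) ∧ ∑' n, tailFn x q s n ≤ C * (q : ℝ) ^ (1 - s + l) := by
  set ζ : ℝ := ∑' n : ℕ, (n : ℝ) ^ (-s) with hζ
  have hζ0 : 0 ≤ ζ := tsum_nonneg fun n => by positivity
  have hζs := summable_nat_rpow_neg hs
  refine ⟨2 * ((ζ + 1) * 2 ^ s * (6 * (1 + 1 / l) * 2 ^ l)), by positivity, fun x q hq h => ?_⟩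
  have hq' : (1 : ℝ) ≤ q := by exact_mod_cast hq
  set L : ℕ := q / 2 + 1 with hL
  set B : ℝ := 6 * (1 + 1 / l) * 2 ^ l * (q : ℝ) ^ (1 + l) with hB
  have hB0 : 0 ≤ B := by positivity
  have hL0 : (0 : ℝ) < L := by positivity
  have hLq : (q : ℝ) / 2 ≤ L := by
    have : q ≤ 2 * L := by omega
    have : (q : ℝ) ≤ 2 * L := by exact_mod_cast this
    linarith
  have hblock : ∀ b : ℕ, ∑ n ∈ Finset.Ico (L * b) (L * (b + 1)), tailFn x q s n ≤
      (b : ℝ) ^ (-s) * ((L : ℝ) ^ (-s) * B) := by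
    intro b
    rcases Nat.eq_zero_or_pos b with rfl | hb
    -- Block 0 consists of `n ≤ q / 2`, where `tailFn` vanishes.
    · refine (Finset.sum_nonpos fun n hn => ?_).trans (by positivity)
      rw [Finset.mem_Ico] at hn
      have : ¬ ((q : ℤ) < 2 * |(n : ℤ)|) := by
        rw [abs_of_nonneg (by positivity)]; omega
      rw [tailFn, if_neg this]
    · have hbL : (0 : ℝ) < (L * b : ℕ) := by positivity
      calc ∑ n ∈ Finset.Ico (L * b) (L * (b + 1)), tailFn x q s n
          ≤ ∑ n ∈ Finset.Ico (L * b) (L * (b + 1)),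
              ((L * b : ℕ) : ℝ) ^ (-s) * majorant x q (n : ℤ) := by
            refine Finset.sum_le_sum fun n hn => ?_
            rw [Finset.mem_Ico] at hn
            have h0 := majorant_nonneg x q n
            unfold tailFn
            split_ifs
            · refine mul_le_mul_of_nonneg_right ?_ h0
              rw [Int.cast_natCast, abs_of_nonneg (by positivity)]
              exact Real.rpow_le_rpow_of_nonpos hbL (by exact_mod_cast hn.1) (by linarith)
            · positivity
        _ = ((L * b : ℕ) : ℝ) ^ (-s) *
              ∑ n ∈ Finset.Ico ((L * b : ℕ) : ℤ) ((L * b : ℕ) + (L : ℤ)), majorant x q n := by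
            rw [← Finset.mul_sum]
            congr 1
            refine Finset.sum_bij (fun n _ => (n : ℤ)) ?_ ?_ ?_ ?_
            · intro n hn
              rw [Finset.mem_Ico] at hn ⊢
              rw [mul_add, mul_one] at hn
              omega
            · intro a _ b _ h; exact_mod_cast h
            · intro n hn
              rw [Finset.mem_Ico] at hn
              refine ⟨n.toNat, ?_, by omega⟩
              rw [Finset.mem_Ico, mul_add, mul_one]
              omega
            · intros; rfl
        _ ≤ ((L * b : ℕ) : ℝ) ^ (-s) * B := by
            gcongr
            exact h.sum_majorant_le hq hl _
        _ = _ := by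
            push_cast
            rw [Real.mul_rpow (by positivity) (by positivity)]
            ring
  have hsum : ∀ M : ℕ, ∑ n ∈ Finset.range (L * M), tailFn x q s n ≤ ζ * ((L : ℝ) ^ (-s) * B) := by
    intro M
    have h1 : ∑ n ∈ Finset.range (L * M), tailFn x q s n ≤
        ∑ b ∈ Finset.range M, (b : ℝ) ^ (-s) * ((L : ℝ) ^ (-s) * B) := by
      induction M with
      | zero => simp
      | succ M ih =>
        rw [Finset.sum_range_succ, Finset.range_eq_Ico,
          ← Finset.sum_Ico_consecutive _ (Nat.zero_le (L * M)) (by gcongr; omega)]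
        rw [← Finset.range_eq_Ico]
        exact add_le_add ih (hblock M)
    refine h1.trans ?_
    rw [← Finset.sum_mul]
    gcongr
    exact hζs.sum_le_tsum _ fun n _ => by positivity
  have hfin : ∀ M : ℕ, ∑ n ∈ Finset.range M, tailFn x q s n ≤ ζ * ((L : ℝ) ^ (-s) * B) := by
    intro M
    refine le_trans (Finset.sum_le_sum_of_subset_of_nonneg ?_ fun n _ _ => tailFn_nonneg _ _ _ _)
      (hsum M)
    refine Finset.range_mono ?_
    exact Nat.le_mul_of_pos_left M (by omega)
  obtain ⟨h1, h2⟩ := summable_int_of_even (tailFn_nonneg x q s)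
    (fun n => by simp [tailFn, majorant_neg]) hfin
  refine ⟨h1, h2.trans ?_⟩
  have h3 : (L : ℝ) ^ (-s) ≤ 2 ^ s * (q : ℝ) ^ (-s) := by
    calc (L : ℝ) ^ (-s) ≤ ((q : ℝ) / 2) ^ (-s) :=
          Real.rpow_le_rpow_of_nonpos (by positivity) hLq (by linarith)
      _ = _ := by
        rw [Real.div_rpow (by positivity) (by norm_num), Real.rpow_neg (by norm_num : (0:ℝ) ≤ 2)]
        field_simp
  have h4 : (q : ℝ) ^ (-s) * (q : ℝ) ^ (1 + l) = (q : ℝ) ^ (1 - s + l) := by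
    rw [← Real.rpow_add (by positivity)]; congr 1; ring
  calc 2 * (ζ * ((L : ℝ) ^ (-s) * B))
      ≤ 2 * ((ζ + 1) * ((2 ^ s * (q : ℝ) ^ (-s)) * B)) := by gcongr; linarith
    _ = 2 * ((ζ + 1) * 2 ^ s * (6 * (1 + 1 / l) * 2 ^ l)) *
        ((q : ℝ) ^ (-s) * (q : ℝ) ^ (1 + l)) := by rw [hB]; ring
    _ = _ := by rw [h4]

/-! ### Small divisor sums over low frequencies. -/

/-- The sum `∑ n ^ (-p) / ‖n x‖` over `0 < 2 n ≤ q`. -/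
noncomputable def headSum (x : UnitAddCircle) (q : ℕ) (p : ℝ) : ℝ :=
  ∑ n ∈ Finset.Icc 1 (q / 2), (n : ℝ) ^ (-p) / ‖(n : ℤ) • x‖

/-- The function `n ↦ |n| ^ (-p) / ‖n x‖`, restricted to `0 < 2 |n| ≤ q`. -/
noncomputable def headFn (x : UnitAddCircle) (q : ℕ) (p : ℝ) (n : ℤ) : ℝ :=
  if n ≠ 0 ∧ 2 * |n| ≤ q then |(n : ℝ)| ^ (-p) / ‖n • x‖ else 0

theorem headFn_nonneg (x : UnitAddCircle) (q : ℕ) (p : ℝ) (n : ℤ) : 0 ≤ headFn x q p n := by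
  unfold headFn; split_ifs <;> positivity

theorem headSum_nonneg (x : UnitAddCircle) (q : ℕ) (p : ℝ) : 0 ≤ headSum x q p :=
  Finset.sum_nonneg fun n _ => by positivity

theorem headFn_sum_le (x : UnitAddCircle) (q : ℕ) (p : ℝ) :
    Summable (headFn x q p) ∧ ∑' n, headFn x q p n ≤ 2 * headSum x q p := by
  refine summable_int_of_even (headFn_nonneg x q p) (fun n => by simp [headFn]) fun M => ?_
  have : ∀ n ∈ Finset.range M, headFn x q p n =
      if n ∈ Finset.Icc 1 (q / 2) then (n : ℝ) ^ (-p) / ‖(n : ℤ) • x‖ else 0 := by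
    intro n _
    unfold headFn
    have : ((n : ℤ) ≠ 0 ∧ 2 * |(n : ℤ)| ≤ q) ↔ n ∈ Finset.Icc 1 (q / 2) := by
      rw [Finset.mem_Icc, abs_of_nonneg (by positivity)]; omega
    rw [if_congr this rfl rfl, Int.cast_natCast, abs_of_nonneg (Nat.cast_nonneg n)]
  rw [Finset.sum_congr rfl this, ← Finset.sum_filter]
  refine Finset.sum_le_sum_of_subset_of_nonneg (fun n hn => (Finset.mem_filter.1 hn).2)
    fun n _ _ => by positivity

theorem headSum_anti (x : UnitAddCircle) (q : ℕ) {p p' : ℝ} (h : p ≤ p') :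
    headSum x q p' ≤ headSum x q p := by
  refine Finset.sum_le_sum fun n hn => ?_
  have : (1 : ℝ) ≤ n := by exact_mod_cast (Finset.mem_Icc.1 hn).1
  gcongr

theorem WellSpaced.headSum_le {x : UnitAddCircle} {q : ℕ} (h : WellSpaced x q) (hq : 1 ≤ q)
    (p : ℝ) : headSum x q p ≤ 2 * q * ∑ n ∈ Finset.Icc 1 (q / 2), (n : ℝ) ^ (-p) := by
  have hq' : (1 : ℝ) ≤ q := by exact_mod_cast hq
  rw [headSum, Finset.mul_sum]
  refine Finset.sum_le_sum fun n hn => ?_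
  rw [Finset.mem_Icc] at hn
  have h1 := h n (by omega) (by rw [abs_of_nonneg (by positivity)]; omega)
  rw [mul_comm, div_eq_mul_inv]
  gcongr
  rw [← inv_inv (2 * (q : ℝ))]
  rw [one_div] at h1
  exact inv_anti₀ (by positivity) h1

theorem WellSpaced.headSum_le_mul {x : UnitAddCircle} {q : ℕ} (h : WellSpaced x q) (hq : 1 ≤ q)
    {p : ℝ} (hp : 1 < p) : headSum x q p ≤ 2 * (∑' n : ℕ, (n : ℝ) ^ (-p)) * q := by
  refine (h.headSum_le hq p).trans ?_
  have := (summable_nat_rpow_neg hp).sum_le_tsum (Finset.Icc 1 (q / 2)) fun n _ => by positivity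
  nlinarith [(Nat.cast_nonneg q : (0 : ℝ) ≤ q)]

theorem WellSpaced.headSum_le_sq {x : UnitAddCircle} {q : ℕ} (h : WellSpaced x q) (hq : 1 ≤ q)
    {p : ℝ} (hp : 0 ≤ p) : headSum x q p ≤ q ^ 2 := by
  refine (h.headSum_le hq p).trans ?_
  have h1 : ∑ n ∈ Finset.Icc 1 (q / 2), (n : ℝ) ^ (-p) ≤ ∑ n ∈ Finset.Icc 1 (q / 2), (1 : ℝ) := by
    refine Finset.sum_le_sum fun n hn => ?_
    exact Real.rpow_le_one_of_one_le_of_nonpos (by exact_mod_cast (Finset.mem_Icc.1 hn).1)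
      (by linarith)
  have h2 : ∑ n ∈ Finset.Icc 1 (q / 2), (1 : ℝ) ≤ q / 2 := by
    simp only [Finset.sum_const, Nat.card_Icc, nsmul_eq_mul, mul_one]
    rw [Nat.add_sub_cancel]
    exact_mod_cast Nat.cast_div_le (α := ℝ) (m := q) (n := 2)
  nlinarith [(Nat.cast_nonneg q : (0 : ℝ) ≤ q)]

/-- The bounds on small denominators up to `q / 2` that make `q` a good rigidity time. -/
def HeadBound (x : UnitAddCircle) (ε C : ℝ) (q : ℕ) (Q : ℝ) : Prop :=
  headSum x q ε / Q ≤ C * (q : ℝ) ^ (-(ε / 5)) ∧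
  headSum x q (2 + 2 * ε) * (headSum x q (1 + 2 * ε) / Q) ≤ C * (q : ℝ) ^ (-(ε / 5))

/-- Both numerators are `O(q ^ 2)` by well-spacing alone, which a `Q` of size `q ^ (2 + ε)` beats.
-/
theorem headBound_of_large_quotient {ε : ℝ} (hε : 0 < ε) :
    ∃ C : ℝ, 0 < C ∧ ∀ (x : UnitAddCircle) (q : ℕ) (Q : ℝ), 1 ≤ q → WellSpaced x q →
      (q : ℝ) ^ (2 + ε) ≤ Q → HeadBound x ε C q Q := by
  set z1 : ℝ := ∑' n : ℕ, (n : ℝ) ^ (-(2 + 2 * ε))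
  set z2 : ℝ := ∑' n : ℕ, (n : ℝ) ^ (-(1 + 2 * ε))
  have hz1 : 0 ≤ z1 := tsum_nonneg fun n => by positivity
  have hz2 : 0 ≤ z2 := tsum_nonneg fun n => by positivity
  refine ⟨1 + 4 * z1 * z2, by positivity, fun x q Q hq h hQ => ?_⟩
  have hq' : (1 : ℝ) ≤ q := by exact_mod_cast hq
  have hQ0 : 0 < Q := lt_of_lt_of_le (by positivity) hQ
  have key : (q : ℝ) ^ 2 / Q ≤ (q : ℝ) ^ (-(ε / 5)) := by
    rw [div_le_iff₀ hQ0]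
    calc (q : ℝ) ^ 2 = (q : ℝ) ^ (2 : ℝ) := by norm_cast
      _ ≤ (q : ℝ) ^ (-(ε / 5) + (2 + ε)) :=
          Real.rpow_le_rpow_of_exponent_le hq' (by linarith)
      _ = (q : ℝ) ^ (-(ε / 5)) * (q : ℝ) ^ (2 + ε) := Real.rpow_add (by positivity) _ _
      _ ≤ _ := by gcongr
  have hp : 0 ≤ (q : ℝ) ^ (-(ε / 5)) := by positivity
  constructor
  · calc headSum x q ε / Q ≤ (q : ℝ) ^ 2 / Q := by gcongr; exact h.headSum_le_sq hq hε.le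
      _ ≤ _ := key
      _ ≤ _ := le_mul_of_one_le_left hp (by nlinarith [mul_nonneg hz1 hz2])
  · calc headSum x q (2 + 2 * ε) * (headSum x q (1 + 2 * ε) / Q)
        ≤ (2 * z1 * q) * ((2 * z2 * q) / Q) := by
          have := headSum_nonneg x q (1 + 2 * ε)
          gcongr
          · exact h.headSum_le_mul hq (by linarith)
          · exact h.headSum_le_mul hq (by linarith)
      _ = 4 * z1 * z2 * ((q : ℝ) ^ 2 / Q) := by ring
      _ ≤ 4 * z1 * z2 * (q : ℝ) ^ (-(ε / 5)) := by gcongr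
      _ ≤ _ := by gcongr; linarith

theorem headSum_zero_le {l : ℝ} (hl : 0 < l) {x : UnitAddCircle} {q : ℕ} (h : WellSpaced x q)
    (hq : 1 ≤ q) : headSum x q 0 ≤ 16 * (1 + 1 / l) * 2 ^ l * (q : ℝ) ^ (1 + l) := by
  have hq' : (1 : ℝ) ≤ q := by exact_mod_cast hq
  have h1 := sum_le_of_separated x ((Finset.Icc 1 (q / 2)).map Nat.castEmbedding)
    (fun n => 1 / ‖n • x‖) (Z := 2 * q) (δ := 1 / (2 * q)) (by positivity) (by positivity)
    (by rw [div_le_one (by positivity)]; linarith) ?_ ?_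
  · rw [Finset.sum_map] at h1
    have h2 : 1 + Real.log (1 / (1 / (2 * (q : ℝ)))) ≤ (1 + 1 / l) * (2 * (q : ℝ)) ^ l := by
      rw [one_div_one_div]
      exact one_add_log_le hl (by linarith)
    have h3 : (1 : ℝ) ≤ 1 + Real.log (1 / (1 / (2 * (q : ℝ)))) := by
      rw [one_div_one_div]
      linarith [Real.log_nonneg (x := 2 * (q : ℝ)) (by linarith)]
    have h4 : (2 : ℝ) / (1 / (2 * q)) = 4 * q := by field_simp; norm_num
    rw [h4] at h1
    calc headSum x q 0 = ∑ n ∈ Finset.Icc 1 (q / 2), 1 / ‖(n : ℤ) • x‖ := by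
          simp [headSum]
      _ ≤ _ := h1
      _ ≤ 16 * q * (1 + Real.log (1 / (1 / (2 * (q : ℝ))))) := by nlinarith
      _ ≤ 16 * q * ((1 + 1 / l) * (2 * (q : ℝ)) ^ l) := by gcongr
      _ = _ := by
        rw [Real.mul_rpow (by norm_num) (by positivity), Real.rpow_add (by positivity),
          Real.rpow_one]
        ring
  · intro n hn
    obtain ⟨k, hk, rfl⟩ := Finset.mem_map.1 hn
    rw [Finset.mem_Icc] at hk
    have h1 := h k (by omega) (by rw [abs_of_nonneg (by positivity)]; omega)
    have h2 : 0 < ‖(k : ℤ) • x‖ := lt_of_lt_of_le (by positivity) h1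
    constructor
    · rw [← one_div_one_div (2 * (q : ℝ))]
      exact one_div_le_one_div_of_le (by positivity) h1
    · show ‖(k : ℤ) • x‖ * (1 / ‖(k : ℤ) • x‖) ≤ 1
      rw [mul_one_div_cancel h2.ne']
  · intro m hm n hn hne
    obtain ⟨k, hk, rfl⟩ := Finset.mem_map.1 hm
    obtain ⟨j, hj, rfl⟩ := Finset.mem_map.1 hn
    rw [Finset.mem_Icc] at hk hj
    refine h _ (sub_ne_zero.2 hne) ?_
    have : |(k : ℤ) - j| ≤ ((q / 2 : ℕ) : ℤ) := by
      rw [abs_le]; push_cast; omega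
    show 2 * |(k : ℤ) - j| ≤ q
    omega

/-- The points `n x` with `n ≤ M` are separated by `δ = c * M ^ (-τ)` from each other and from 0, so
the sum is of order `(1 / δ) log (1 / δ)`. -/
theorem sum_inv_norm_le_of_diophantine {x : UnitAddCircle} {c τ : ℝ} (hc : 0 < c) (hc1 : c ≤ 1)
    (hτ : 0 < τ) (hx : ∀ n : ℕ, 1 ≤ n → c * (n : ℝ) ^ (-τ) ≤ ‖(n : ℤ) • x‖) {l : ℝ} (hl : 0 < l)
    {M : ℕ} (hM : 1 ≤ M) :
    ∑ n ∈ Finset.Icc 1 M, 1 / ‖(n : ℤ) • x‖ ≤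
      4 * (1 + 1 / l) * c ^ (-(1 + l)) * (M : ℝ) ^ (τ * (1 + l)) := by
  have hM' : (1 : ℝ) ≤ M := by exact_mod_cast hM
  set δ : ℝ := c * (M : ℝ) ^ (-τ) with hδ
  have hδ0 : 0 < δ := by positivity
  have hδ1 : δ ≤ 1 :=
    mul_le_one₀ hc1 (by positivity) (Real.rpow_le_one_of_one_le_of_nonpos hM' (by linarith))
  have hlow : ∀ n : ℤ, n ≠ 0 → |n| ≤ M → δ ≤ ‖n • x‖ := by
    intro n hn hnM
    have h1 : ‖n • x‖ = ‖((n.natAbs : ℕ) : ℤ) • x‖ := by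
      rcases Int.natAbs_eq n with h | h
      · rw [← h]
      · rw [h]; simp
    rw [h1]
    have h2 : 1 ≤ n.natAbs := by omega
    refine le_trans ?_ (hx _ h2)
    rw [hδ]
    gcongr ?_ * ?_
    refine Real.rpow_le_rpow_of_nonpos (by exact_mod_cast h2) ?_ (by linarith)
    have : n.natAbs ≤ M := by rw [Int.abs_eq_natAbs] at hnM; omega
    exact_mod_cast this
  have h1 := sum_le_of_separated x ((Finset.Icc 1 M).map Nat.castEmbedding)
    (fun n => 1 / ‖n • x‖) (Z := 1 / δ) (δ := δ) (by positivity) hδ0 hδ1 ?_ ?_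
  · rw [Finset.sum_map] at h1
    have hδ' : 1 ≤ 1 / δ := (one_le_div hδ0).2 hδ1
    have h2 := one_add_log_le hl hδ'
    have h3 : (1 : ℝ) ≤ 1 + Real.log (1 / δ) := by linarith [Real.log_nonneg hδ']
    have h4 : 2 / δ = 2 * (1 / δ) := by ring
    rw [h4] at h1
    calc _ ≤ _ := h1
      _ ≤ 4 * (1 / δ) * (1 + Real.log (1 / δ)) := by nlinarith
      _ ≤ 4 * (1 / δ) * ((1 + 1 / l) * (1 / δ) ^ l) := by gcongr
      _ = 4 * (1 + 1 / l) * (1 / δ) ^ (1 + l) := by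
        rw [Real.rpow_add (by positivity), Real.rpow_one]; ring
      _ = _ := by
        rw [one_div δ, Real.inv_rpow hδ0.le, ← Real.rpow_neg hδ0.le, hδ,
          Real.mul_rpow hc.le (by positivity), ← Real.rpow_mul (by positivity)]
        rw [show -τ * -(1 + l) = τ * (1 + l) by ring]
        ring
  · intro n hn
    obtain ⟨k, hk, rfl⟩ := Finset.mem_map.1 hn
    rw [Finset.mem_Icc] at hk
    have h1 := hlow k (by omega) (by rw [abs_of_nonneg (by positivity)]; omega)
    have h2 : 0 < ‖(k : ℤ) • x‖ := lt_of_lt_of_le (by positivity) h1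
    constructor
    · exact one_div_le_one_div_of_le (by positivity) h1
    · show ‖(k : ℤ) • x‖ * (1 / ‖(k : ℤ) • x‖) ≤ 1
      rw [mul_one_div_cancel h2.ne']
  · intro m hm n hn hne
    obtain ⟨k, hk, rfl⟩ := Finset.mem_map.1 hm
    obtain ⟨j, hj, rfl⟩ := Finset.mem_map.1 hn
    rw [Finset.mem_Icc] at hk hj
    refine hlow _ (sub_ne_zero.2 hne) ?_
    show |(k : ℤ) - j| ≤ M
    rw [abs_le]; omega

/-- Partial summation, in the form of the convergence criterion for Dirichlet series with
nonnegative coefficients `1 / ‖n x‖`. The growth exponent `(2 + ε)(1 + ε/6)` of the partial sums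
stays below `2 + 2ε`. -/
theorem headSum_bounded_of_diophantine {x : UnitAddCircle} {c ε : ℝ} (hc : 0 < c) (hc1 : c ≤ 1)
    (hε : 0 < ε) (hε1 : ε < 1)
    (hx : ∀ n : ℕ, 1 ≤ n → c * (n : ℝ) ^ (-(2 + ε)) ≤ ‖(n : ℤ) • x‖) :
    ∃ C : ℝ, 0 < C ∧ ∀ q : ℕ, headSum x q (2 + 2 * ε) ≤ C := by
  have hO : (fun n : ℕ => ∑ k ∈ Finset.Icc 1 n, 1 / ‖(k : ℤ) • x‖) =O[atTop]
      fun n : ℕ => (n : ℝ) ^ ((2 + ε) * (1 + ε / 6)) := by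
    refine Asymptotics.IsBigO.of_bound
      (4 * (1 + 1 / (ε / 6)) * c ^ (-(1 + ε / 6))) ?_
    filter_upwards [eventually_ge_atTop 1] with n hn
    rw [Real.norm_of_nonneg (Finset.sum_nonneg fun k _ => by positivity),
      Real.norm_of_nonneg (by positivity)]
    exact sum_inv_norm_le_of_diophantine hc hc1 (by linarith) hx (by linarith) hn
  have h1 := LSeriesSummable_of_sum_norm_bigO_and_nonneg (s := ((2 + 2 * ε : ℝ) : ℂ)) hO
    (fun n => by positivity) (by positivity) (by rw [Complex.ofReal_re]; nlinarith)
  have h2 : Summable (fun n : ℕ => ‖LSeries.term (fun n => ((1 / ‖(n : ℤ) • x‖ : ℝ) : ℂ))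
      ((2 + 2 * ε : ℝ) : ℂ) n‖) := h1.norm
  obtain ⟨T, hT⟩ : ∃ T : ℝ, ∀ q : ℕ, ∑ n ∈ Finset.Icc 1 (q / 2),
      ‖LSeries.term (fun n => ((1 / ‖(n : ℤ) • x‖ : ℝ) : ℂ)) ((2 + 2 * ε : ℝ) : ℂ) n‖ ≤ T :=
    ⟨_, fun q => h2.sum_le_tsum (Finset.Icc 1 (q / 2)) fun n _ => norm_nonneg _⟩
  refine ⟨|T| + 1, by positivity, fun q => le_trans (le_of_eq ?_)
    ((hT q).trans ((le_abs_self T).trans (le_add_of_nonneg_right zero_le_one)))⟩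
  refine Finset.sum_congr rfl fun n hn => ?_
  rw [Finset.mem_Icc] at hn
  rw [LSeries.norm_term_eq, if_neg (by omega), Complex.norm_real, Complex.ofReal_re,
    Real.norm_of_nonneg (by positivity), Real.rpow_neg (by positivity)]
  field_simp

/-- The sum with weight `n ^ (-ε)` is interpolated between the unweighted one, nearly `O(q)`, and
the bounded one with weight `n ^ (-(2 + 2ε))`. The gain over `q` already suffices, since `Q ≥ q`. -/
theorem headBound_of_diophantine {x : UnitAddCircle} {c ε : ℝ} (hc : 0 < c) (hc1 : c ≤ 1)
    (hε : 0 < ε) (hε1 : ε < 1)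
    (hx : ∀ n : ℕ, 1 ≤ n → c * (n : ℝ) ^ (-(2 + ε)) ≤ ‖(n : ℤ) • x‖) :
    ∃ C : ℝ, 0 < C ∧ ∀ (q : ℕ) (Q : ℝ), 1 ≤ q → WellSpaced x q → (q : ℝ) ≤ Q →
      HeadBound x ε C q Q := by
  obtain ⟨G, hG0, hG⟩ := headSum_bounded_of_diophantine hc hc1 hε hε1 hx
  have hl : 0 < ε / 20 := by linarith
  set K : ℝ := 16 * (1 + 1 / (ε / 20)) * 2 ^ (ε / 20)
  have hK : 0 < K := by positivity
  refine ⟨(K + G) * (1 + G), by positivity, fun q Q hq h hQ => ?_⟩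
  have hq' : (1 : ℝ) ≤ q := by exact_mod_cast hq
  have hQ0 : 0 < Q := by linarith
  have hp : 0 ≤ (q : ℝ) ^ (-(ε / 5)) := by positivity
  have h0 : headSum x q ε ≤ (q : ℝ) ^ (-(ε / 4)) * headSum x q 0 +
      (q : ℝ) ^ ((2 + ε) / 4) * headSum x q (2 + 2 * ε) := by
    unfold headSum
    rw [Finset.mul_sum, Finset.mul_sum, ← Finset.sum_add_distrib]
    refine Finset.sum_le_sum fun n hn => ?_
    rw [Finset.mem_Icc] at hn
    have hn1 : (1 : ℝ) ≤ n := by exact_mod_cast hn.1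
    rw [← mul_div_assoc, ← mul_div_assoc, ← add_div]
    gcongr
    -- Beyond `q ^ (1/4)` the weight `n ^ (-ε)` itself is small; below it, the Diophantine sum costs
    -- only `q ^ ((2 + ε) / 4)`, well under `q`.
    rcases le_total ((q : ℝ) ^ ((1 : ℝ) / 4)) n with hc | hc
    · have h1 : (n : ℝ) ^ (-ε) ≤ (q : ℝ) ^ (-(ε / 4)) := by
        calc (n : ℝ) ^ (-ε) ≤ ((q : ℝ) ^ ((1 : ℝ) / 4)) ^ (-ε) :=
              Real.rpow_le_rpow_of_nonpos (by positivity) hc (by linarith)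
          _ = _ := by rw [← Real.rpow_mul (by positivity)]; congr 1; ring
      have h2 : 0 ≤ (q : ℝ) ^ ((2 + ε) / 4) * (n : ℝ) ^ (-(2 + 2 * ε)) := by positivity
      rw [neg_zero, Real.rpow_zero]
      linarith
    · have h1 : (n : ℝ) ^ (-ε) ≤ (q : ℝ) ^ ((2 + ε) / 4) * (n : ℝ) ^ (-(2 + 2 * ε)) := by
        calc (n : ℝ) ^ (-ε) = (n : ℝ) ^ (2 + ε) * (n : ℝ) ^ (-(2 + 2 * ε)) := by
              rw [← Real.rpow_add (by positivity)]; congr 1; ring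
          _ ≤ ((q : ℝ) ^ ((1 : ℝ) / 4)) ^ (2 + ε) * (n : ℝ) ^ (-(2 + 2 * ε)) := by gcongr
          _ = _ := by
            rw [← Real.rpow_mul (by positivity)]; congr 2; ring
      have h2 : 0 ≤ (q : ℝ) ^ (-(ε / 4)) * (n : ℝ) ^ (-(0 : ℝ)) := by positivity
      linarith
  have h1 : headSum x q ε / Q ≤ (K + G) * (q : ℝ) ^ (-(ε / 5)) := by
    rw [div_le_iff₀ hQ0]
    have e1 : (q : ℝ) ^ (-(ε / 4)) * (K * (q : ℝ) ^ (1 + ε / 20)) =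
        K * ((q : ℝ) ^ (-(ε / 5)) * q) := by
      have : (q : ℝ) ^ (-(ε / 4)) * (q : ℝ) ^ (1 + ε / 20) = (q : ℝ) ^ (-(ε / 5)) * q := by
        nth_rewrite 4 [← Real.rpow_one (q : ℝ)]
        rw [← Real.rpow_add (by positivity), ← Real.rpow_add (by positivity)]
        congr 1; ring
      rw [← this]; ring
    have e2 : (q : ℝ) ^ ((2 + ε) / 4) ≤ (q : ℝ) ^ (-(ε / 5)) * q := by
      nth_rewrite 3 [← Real.rpow_one (q : ℝ)]
      rw [← Real.rpow_add (by positivity)]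
      exact Real.rpow_le_rpow_of_exponent_le hq' (by linarith)
    calc headSum x q ε ≤ _ := h0
      _ ≤ (q : ℝ) ^ (-(ε / 4)) * (K * (q : ℝ) ^ (1 + ε / 20)) +
          ((q : ℝ) ^ (-(ε / 5)) * q) * G := by
        have := headSum_nonneg x q (2 + 2 * ε)
        gcongr
        · exact headSum_zero_le hl h hq
        · exact hG q
      _ = (K + G) * (q : ℝ) ^ (-(ε / 5)) * q := by rw [e1]; ring
      _ ≤ _ := by gcongr
  refine ⟨h1.trans ?_, ?_⟩
  · gcongr
    nlinarith [mul_pos hK hG0, mul_pos hG0 hG0]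
  · calc headSum x q (2 + 2 * ε) * (headSum x q (1 + 2 * ε) / Q)
        ≤ (1 + G) * ((K + G) * (q : ℝ) ^ (-(ε / 5))) := by
          have := headSum_nonneg x q (1 + 2 * ε)
          gcongr
          · linarith [hG q]
          · refine le_trans ?_ h1
            gcongr
            exact headSum_anti x q (by linarith)
      _ = _ := by ring

/-! ### Continued fraction denominators -/

section ContFract

open GenContFract

/-- The continuants are real by construction; integrality follows from the recurrence, whose partial
numerators are 1 and partial denominators integers. -/
theorem exists_int_contsAux (v : ℝ) (n : ℕ) :
    ∃ a b : ℤ, (GenContFract.of v).contsAux n = ⟨(a : ℝ), (b : ℝ)⟩ := by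
  induction n using Nat.strong_induction_on with
  | _ n IH =>
    rcases n with (_ | _ | n)
    · exact ⟨1, 0, by simp [contsAux]⟩
    · exact ⟨⌊v⌋, 1, by simp [contsAux]⟩
    · obtain ⟨a, b, hab⟩ := IH (n + 1) (by omega)
      obtain ⟨a', b', hab'⟩ := IH n (by omega)
      rcases hs : (GenContFract.of v).s.get? n with _ | gp
      · exact ⟨a, b, by rw [contsAux_stable_of_terminated (n + 1).le_succ hs, hab]⟩
      · obtain ⟨h1, z, h2⟩ := of_partNum_eq_one_and_exists_int_partDen_eq hs
        refine ⟨z * a + a', z * b + b', ?_⟩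
        rw [contsAux_recurrence hs hab' hab, h1, h2]
        push_cast
        simp

theorem exists_int_nums_dens (v : ℝ) (n : ℕ) :
    ∃ a b : ℤ, (GenContFract.of v).nums n = a ∧ (GenContFract.of v).dens n = b := by
  obtain ⟨a, b, h⟩ := exists_int_contsAux v (n + 1)
  refine ⟨a, b, ?_, ?_⟩
  · rw [num_eq_conts_a, nth_cont_eq_succ_nth_contAux, h]
  · rw [den_eq_conts_b, nth_cont_eq_succ_nth_contAux, h]

theorem not_terminatedAt_of_irrational {v : ℝ} (hv : Irrational v) (n : ℕ) :
    ¬ (GenContFract.of v).TerminatedAt n := fun h => by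
  obtain ⟨q, hq⟩ := (terminates_iff_rat v).1 ⟨n, h⟩
  exact hv ⟨q, hq.symm⟩

/-- Well-spacing: for `0 < |k| ≤ b / 2` the number `k a / b` is at least `1 / b` from every integer,
as `a` and `b` are coprime, and replacing `a / b` by `α` moves it by at most `1 / (2 b)`. -/
theorem exists_denominators {α : ℝ} (hα : Irrational α) :
    ∃ q : ℕ → ℕ, (∀ n, (q n : ℝ) = (GenContFract.of α).dens n) ∧ Monotone q ∧ (∀ n, 1 ≤ q n) ∧
      Tendsto q atTop atTop ∧ (∀ n, ‖q n • (α : UnitAddCircle)‖ ≤ 1 / (q (n + 1) : ℝ)) ∧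
      ∀ n, WellSpaced (α : UnitAddCircle) (q n) := by
  choose a b ha hb using exists_int_nums_dens α
  have hnt := not_terminatedAt_of_irrational hα
  have hfib : ∀ n, (Nat.fib (n + 1) : ℝ) ≤ b n := fun n => by
    rw [← hb]; exact succ_nth_fib_le_of_nth_den (Or.inr (hnt _))
  have hb1 : ∀ n, 1 ≤ b n := fun n => by
    have h1 : (1 : ℝ) ≤ Nat.fib (n + 1) := by
      exact_mod_cast Nat.fib_pos.2 (Nat.succ_pos n)
    exact_mod_cast h1.trans (hfib n)
  have hmono : Monotone b := monotone_nat_of_le_succ fun n => by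
    have := of_den_mono (v := α) (n := n)
    rw [hb, hb] at this
    exact_mod_cast this
  have hq : ∀ n, (((b n).toNat : ℕ) : ℝ) = b n := fun n => by
    have : (((b n).toNat : ℕ) : ℤ) = b n := Int.toNat_of_nonneg (by linarith [hb1 n])
    exact_mod_cast congrArg (fun z : ℤ => (z : ℝ)) this
  have happrox : ∀ n, |α - a n / b n| ≤ 1 / (b n * b (n + 1)) := fun n => by
    have := abs_sub_convs_le (hnt n)
    rwa [conv_eq_num_div_den, ha, hb, hb] at this
  have hbR : ∀ n, (1 : ℝ) ≤ b n := fun n => by exact_mod_cast hb1 n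
  refine ⟨fun n => (b n).toNat, fun n => by rw [hq, hb], fun m n h => Int.toNat_le_toNat (hmono h),
    fun n => Int.lt_toNat.2 (Int.lt_of_lt_of_le zero_lt_one (hb1 n)), ?_, fun n => ?_, fun n => ?_⟩
  · refine tendsto_atTop.2 fun K => ?_
    -- The shift by 5 is the threshold from which `n ≤ Nat.fib n`.
    filter_upwards [eventually_ge_atTop (K + 5)] with n hn
    have h1 : n + 1 ≤ Nat.fib (n + 1) := Nat.le_fib_self (by omega)
    have h2 : (Nat.fib (n + 1) : ℤ) ≤ b n := by exact_mod_cast hfib n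
    omega
  · have h0 : ((b n).toNat • (α : UnitAddCircle)) = (((b n : ℝ) * α - a n : ℝ) : UnitAddCircle) := by
      rw [AddCircle.coe_sub]
      have : ((a n : ℝ) : UnitAddCircle) = 0 :=
        (AddCircle.coe_eq_zero_iff (p := (1 : ℝ))).2 ⟨a n, by simp⟩
      rw [this, sub_zero, ← hq, ← nsmul_eq_mul, AddCircle.coe_nsmul]
    rw [h0, hq]
    refine (norm_coe_le_abs _).trans ?_
    have hpos : (0 : ℝ) < b n := by linarith [hbR n]
    have h1 : (b n : ℝ) * α - a n = b n * (α - a n / b n) := by field_simp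
    rw [h1, abs_mul, abs_of_pos hpos]
    calc (b n : ℝ) * |α - a n / b n| ≤ b n * (1 / (b n * b (n + 1))) := by
          gcongr; exact happrox n
      _ = 1 / b (n + 1) := by field_simp
  · intro k hk hkq
    have hqi : (((b n).toNat : ℕ) : ℤ) = b n := Int.toNat_of_nonneg (by linarith [hb1 n])
    rw [hqi] at hkq
    rw [hq, ← AddCircle.coe_zsmul, zsmul_eq_mul, UnitAddCircle.norm_eq]
    set j := round ((k : ℝ) * α)
    have hpos : (0 : ℝ) < b n := by linarith [hbR n]
    -- The determinant identity for consecutive convergents is a Bézout relation up to sign.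
    have hcop : IsCoprime (a n) (b n) := by
      have hd : a n * b (n + 1) - b n * a (n + 1) = (-1) ^ (n + 1) := by
        have := SimpContFract.determinant (s := SimpContFract.of α) (n := n) (hnt n)
        have h2 : (a n : ℝ) * b (n + 1) - b n * a (n + 1) = (-1) ^ (n + 1) := by
          rw [← ha, ← hb, ← ha, ← hb]; exact this
        exact_mod_cast h2
      refine ⟨(-1) ^ (n + 1) * b (n + 1), -((-1) ^ (n + 1) * a (n + 1)), ?_⟩
      have h3 : ((-1 : ℤ) ^ (n + 1)) * (-1) ^ (n + 1) = 1 := by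
        rw [← mul_pow]; simp
      linear_combination (-1 : ℤ) ^ (n + 1) * hd + h3
    have hne : k * a n - j * b n ≠ 0 := by
      intro h
      have h1 : b n ∣ k * a n := ⟨j, by linarith⟩
      have h2 : b n ∣ k := hcop.symm.dvd_of_dvd_mul_right h1
      have h3 := Int.le_of_dvd (abs_pos.2 hk) ((dvd_abs _ _).2 h2)
      have := abs_pos.2 hk
      omega
    have hge : (1 : ℝ) ≤ |(k : ℝ) * a n - j * b n| := by
      have : 1 ≤ |k * a n - j * b n| := Int.one_le_abs hne
      exact_mod_cast this
    have e : (k : ℝ) * α - j = k * (α - a n / b n) + (k * a n - j * b n) / b n := by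
      field_simp; ring
    have h1 : |(k : ℝ) * (α - a n / b n)| ≤ 1 / (2 * b n) := by
      rw [abs_mul]
      have hk2 : |(k : ℝ)| ≤ b n / 2 := by
        have : (2 : ℝ) * |(k : ℝ)| ≤ b n := by exact_mod_cast hkq
        linarith
      have hbb : (b n : ℝ) ≤ b (n + 1) := by exact_mod_cast hmono (Nat.le_succ n)
      calc |(k : ℝ)| * |α - a n / b n| ≤ (b n / 2) * (1 / (b n * b n)) := by
            gcongr
            refine (happrox n).trans ?_
            gcongr
        _ = _ := by field_simp
    have h2 : 1 / (b n : ℝ) ≤ |((k : ℝ) * a n - j * b n) / b n| := by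
      rw [abs_div, abs_of_pos hpos]
      gcongr
    have h3 : (1 : ℝ) / b n = 1 / (2 * b n) + 1 / (2 * b n) := by field_simp; norm_num
    rw [e]
    have h4 := abs_sub_abs_le_abs_sub (((k : ℝ) * a n - j * b n) / b n)
      (-((k : ℝ) * (α - a n / b n)))
    rw [abs_neg, sub_neg_eq_add, add_comm] at h4
    linarith

end ContFract

/-- An irrational rotation has infinitely many denominators `q` satisfying `HeadBound`. -/
theorem frequently_headBound {x : UnitAddCircle} {q : ℕ → ℕ} (hmono : Monotone q)
    (h1 : ∀ n, 1 ≤ q n) (htop : Tendsto q atTop atTop) (hws : ∀ n, WellSpaced x (q n))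
    {ε : ℝ} (hε : 0 < ε) (hε1 : ε < 1) :
    ∃ C : ℝ, 0 < C ∧ ∃ᶠ n in atTop, HeadBound x ε C (q n) (q (n + 1)) := by
  by_cases hf : ∃ᶠ n in atTop, ((q n : ℕ) : ℝ) ^ (2 + ε) ≤ (q (n + 1) : ℝ)
  · obtain ⟨C, hC, h⟩ := headBound_of_large_quotient hε
    exact ⟨C, hC, hf.mono fun n hn => h x (q n) _ (h1 n) (hws n) hn⟩
  · rw [not_frequently, eventually_atTop] at hf
    obtain ⟨m₀, hm₀⟩ := hf
    have hq0 : (1 : ℝ) ≤ q m₀ := by exact_mod_cast h1 m₀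
    -- Slow growth of denominators makes `x` Diophantine. Take the least `m` with `2 n ≤ q m`:
    -- well-spacing gives `‖n x‖ ≥ 1 / (2 q m)`. If `m > m₀`, then `q (m - 1) < 2 n` and hence `q m
    -- ≤ 8 n ^ (2 + ε)`. The factor `q m₀` covers `m ≤ m₀`.
    have hx : ∀ n : ℕ, 1 ≤ n → 1 / (16 * (q m₀ : ℝ)) * (n : ℝ) ^ (-(2 + ε)) ≤ ‖(n : ℤ) • x‖ := by
      intro n hn
      have hn' : (1 : ℝ) ≤ n := by exact_mod_cast hn
      have hex : ∃ m, 2 * n ≤ q m := (htop.eventually_ge_atTop (2 * n)).exists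
      obtain ⟨m, hm, hmin⟩ := Nat.findX hex
      have hle := hws m n (by omega) (by rw [abs_of_nonneg (by positivity)]; omega)
      refine le_trans ?_ hle
      have hqm : (1 : ℝ) ≤ q m := by exact_mod_cast h1 m
      have hnp : (n : ℝ) ^ (-(2 + ε)) ≤ 1 :=
        Real.rpow_le_one_of_one_le_of_nonpos hn' (by linarith)
      rcases le_or_gt m m₀ with hmm | hmm
      · have : (q m : ℝ) ≤ q m₀ := by exact_mod_cast hmono hmm
        calc 1 / (16 * (q m₀ : ℝ)) * (n : ℝ) ^ (-(2 + ε)) ≤ 1 / (16 * (q m₀ : ℝ)) * 1 := by gcongr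
          _ = 1 / (16 * (q m₀ : ℝ)) := mul_one _
          _ ≤ 1 / (2 * (q m : ℝ)) := by gcongr; norm_num
      · obtain ⟨m', rfl⟩ : ∃ m', m = m' + 1 := ⟨m - 1, by omega⟩
        have h2 := hm₀ m' (by omega)
        have h3 := hmin m' (by omega)
        push Not at h2 h3
        have h4 : (q m' : ℝ) ≤ 2 * n := by exact_mod_cast h3.le
        have h5 : (q (m' + 1) : ℝ) ≤ 8 * (n : ℝ) ^ (2 + ε) := by
          calc (q (m' + 1) : ℝ) ≤ (q m' : ℝ) ^ (2 + ε) := h2.le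
            _ ≤ (2 * (n : ℝ)) ^ (2 + ε) := by gcongr
            _ = 2 ^ (2 + ε) * (n : ℝ) ^ (2 + ε) := Real.mul_rpow (by norm_num) (by positivity)
            _ ≤ 2 ^ (3 : ℝ) * (n : ℝ) ^ (2 + ε) := by
              gcongr
              · norm_num
              · linarith
            _ = _ := by norm_num
        rw [Real.rpow_neg (by positivity)]
        calc 1 / (16 * (q m₀ : ℝ)) * ((n : ℝ) ^ (2 + ε))⁻¹
            ≤ 1 / (16 * 1) * ((n : ℝ) ^ (2 + ε))⁻¹ := by gcongr
          _ = 1 / (2 * (8 * (n : ℝ) ^ (2 + ε))) := by field_simp; norm_num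
          _ ≤ 1 / (2 * (q (m' + 1) : ℝ)) := by gcongr
    obtain ⟨C, hC, h⟩ := headBound_of_diophantine (c := 1 / (16 * (q m₀ : ℝ))) (by positivity)
      (by rw [div_le_one (by positivity)]; linarith) hε hε1 hx
    exact ⟨C, hC, Eventually.frequently (Eventually.of_forall fun n =>
      h (q n) _ (h1 n) (hws n) (by exact_mod_cast hmono (Nat.le_succ n)))⟩

/-! ### Birkhoff sums of smooth functions -/

/-- `f` is the sum of a Fourier series with coefficients `c` that decay like `C * |n| ^ (-r)`. -/
structure HasFourierDecay (f : UnitAddCircle → ℝ) (c : ℤ → ℂ) (C r : ℝ) : Prop where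
  nonneg : 0 ≤ C
  hasSum : ∀ y, HasSum (fun n => c n * fourier n y) (f y : ℂ)
  bound : ∀ n, n ≠ 0 → ‖c n‖ ≤ C * |(n : ℝ)| ^ (-r)

theorem summable_int_rpow_neg {r : ℝ} (hr : 1 < r) : Summable fun n : ℤ => |(n : ℝ)| ^ (-r) :=
  (summable_int_of_even (fun n => by positivity) (fun n => by simp) fun M => by
    have := (summable_nat_rpow_neg hr).sum_le_tsum (Finset.range M) fun n _ => by positivity
    simpa using this).1

theorem fourierCoeffOn_eq_fourierCoeff_circleFun {f : ℝ → ℝ} (hp : Function.Periodic f 1)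
    (hc : Continuous f) (n : ℤ) :
    fourierCoeffOn (zero_lt_one' ℝ) (fun t => (f t : ℂ)) n =
      fourierCoeff (fun y : UnitAddCircle => ((circleFun f hp hc y : ℝ) : ℂ)) n := by
  rw [fourierCoeffOn_eq_integral, fourierCoeff_eq_intervalIntegral _ n 0, zero_add, sub_zero]
  simp only [circleFun_coe]

/-- Since `r > 1` the coefficients are summable, so the Fourier series converges to `f` at every
point. -/
theorem IsSmoothPeriodic.exists_hasFourierDecay {r : ℝ} {f : ℝ → ℝ} (hf : IsSmoothPeriodic r f)
    (hr : 1 < r) :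
    ∃ (c : ℤ → ℂ) (C : ℝ), HasFourierDecay (circleFun f hf.periodic hf.continuous) c C r ∧
      c 0 = ((∫ t in (0 : ℝ)..1, f t : ℝ) : ℂ) := by
  obtain ⟨C, hC⟩ := hf.decay
  set g : C(UnitAddCircle, ℂ) :=
    ⟨fun y => ((circleFun f hf.periodic hf.continuous y : ℝ) : ℂ),
      Complex.continuous_ofReal.comp (circleFun f hf.periodic hf.continuous).continuous⟩ with hg
  have hco : ∀ n, fourierCoeff g n = fourierCoeffOn (zero_lt_one' ℝ) (fun t => (f t : ℂ)) n :=
    fun n => (fourierCoeffOn_eq_fourierCoeff_circleFun hf.periodic hf.continuous n).symm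
  have hb : ∀ n : ℤ, n ≠ 0 → ‖fourierCoeff g n‖ ≤ |C| * |(n : ℝ)| ^ (-r) := fun n hn => by
    rw [hco]
    refine (hC n hn).trans ?_
    gcongr
    exact le_abs_self C
  have hs : Summable (fourierCoeff g) := by
    refine Summable.of_norm_bounded_eventually
      ((summable_int_rpow_neg hr).mul_left |C|) ?_
    filter_upwards [(Set.finite_singleton (0 : ℤ)).compl_mem_cofinite] with n hn
    exact hb n hn
  refine ⟨fourierCoeff g, |C|, ⟨abs_nonneg C, fun y => ?_, hb⟩, ?_⟩
  · exact has_pointwise_sum_fourier_series_of_summable hs y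
  · rw [fourierCoeff_eq_intervalIntegral _ 0 0, ← intervalIntegral.integral_ofReal]
    simp [hg]

theorem HasFourierDecay.mono {f : UnitAddCircle → ℝ} {c : ℤ → ℂ} {C r s : ℝ}
    (h : HasFourierDecay f c C r) (hs : s ≤ r) : HasFourierDecay f c C s := by
  refine ⟨h.nonneg, h.hasSum, fun n hn => (h.bound n hn).trans ?_⟩
  have : (1 : ℝ) ≤ |(n : ℝ)| := by exact_mod_cast Int.one_le_abs hn
  have := h.nonneg
  gcongr

/-- The function `n ↦ |n| ^ (-r) * ‖expSum x q n‖`. -/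
noncomputable def expFn (x : UnitAddCircle) (q : ℕ) (r : ℝ) (n : ℤ) : ℝ :=
  |(n : ℝ)| ^ (-r) * ‖expSum x q n‖

theorem expFn_nonneg (x : UnitAddCircle) (q : ℕ) (r : ℝ) (n : ℤ) : 0 ≤ expFn x q r n := by
  unfold expFn; positivity

theorem WellSpaced.norm_pos {x : UnitAddCircle} {q : ℕ} (h : WellSpaced x q) (hq : 1 ≤ q) {n : ℤ}
    (hn : n ≠ 0) (hnq : 2 * |n| ≤ q) : 0 < ‖n • x‖ :=
  lt_of_lt_of_le (by have : (0 : ℝ) < q := by exact_mod_cast hq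
                     positivity) (h n hn hnq)

/-- For low frequencies the numerator of the geometric sum costs one factor `|n|`, lowering the
exponent to `r - 1`; high frequencies use the majorant. The 4 combines the 2 of the geometric sum
bound with the two signs of `n`. -/
theorem expFn_sum_le {r l : ℝ} (hr : 1 < r) (hl : 0 < l) :
    ∃ C : ℝ, 0 < C ∧ ∀ (x : UnitAddCircle) (q : ℕ) (Q : ℝ), 1 ≤ q → WellSpaced x q → 0 < Q →
      ‖q • x‖ ≤ 1 / Q → Summable (expFn x q r) ∧
        ∑' n, expFn x q r n ≤ 4 * (headSum x q (r - 1) / Q) + C * (q : ℝ) ^ (1 - r + l) := by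
  obtain ⟨C, hC, h⟩ := tail_sum_le hr hl
  refine ⟨C, hC, fun x q Q hq hw hQ hqQ => ?_⟩
  obtain ⟨hT1, hT2⟩ := h x q hq hw
  obtain ⟨hH1, hH2⟩ := headFn_sum_le x q (r - 1)
  have hle : ∀ n, expFn x q r n ≤ 2 / Q * headFn x q (r - 1) n + tailFn x q r n := by
    intro n
    have h0 := tailFn_nonneg x q r n
    have h1 := headFn_nonneg x q (r - 1) n
    rcases eq_or_ne n 0 with rfl | hn
    -- The zero frequency drops out because `0 ^ (-r) = 0` for real powers with `r ≠ 0`.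
    · rw [expFn]
      simp only [Int.cast_zero, abs_zero, Real.zero_rpow (neg_ne_zero.2 (by linarith : r ≠ 0)),
        zero_mul]
      positivity
    rcases lt_or_ge (q : ℤ) (2 * |n|) with hlt | hge
    · have : expFn x q r n ≤ tailFn x q r n := by
        rw [expFn, tailFn, if_pos hlt]
        gcongr
        exact norm_expSum_le_majorant x q n
      have : 0 ≤ 2 / Q * headFn x q (r - 1) n := by positivity
      linarith
    · have hpos := hw.norm_pos hq hn hge
      have : expFn x q r n ≤ 2 / Q * headFn x q (r - 1) n := by
        rw [expFn, headFn, if_pos ⟨hn, hge⟩]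
        have hn0 : (0 : ℝ) < |(n : ℝ)| := abs_pos.2 (by exact_mod_cast hn)
        calc |(n : ℝ)| ^ (-r) * ‖expSum x q n‖
            ≤ |(n : ℝ)| ^ (-r) * (2 * |(n : ℝ)| / (Q * ‖n • x‖)) := by
              gcongr
              exact norm_expSum_le_of_norm_nsmul_le hQ hqQ (norm_pos_iff.1 hpos)
          _ = 2 / Q * ((|(n : ℝ)| ^ (-r) * |(n : ℝ)|) / ‖n • x‖) := by field_simp
          _ = _ := by
              rw [show -(r - 1) = -r + 1 by ring, Real.rpow_add hn0, Real.rpow_one]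
      linarith
  have hs := (hH1.mul_left (2 / Q)).add hT1
  have hS : Summable (expFn x q r) := Summable.of_nonneg_of_le (expFn_nonneg x q r) hle hs
  refine ⟨hS, (hS.tsum_le_tsum hle hs).trans ?_⟩
  rw [(hH1.mul_left (2 / Q)).tsum_add hT1, tsum_mul_left]
  refine add_le_add ?_ hT2
  calc 2 / Q * ∑' n, headFn x q (r - 1) n ≤ 2 / Q * (2 * headSum x q (r - 1)) := by gcongr
    _ = _ := by ring

theorem fourier_apply_add (n : ℤ) (s t : UnitAddCircle) :
    (fourier n (s + t) : ℂ) = fourier n s * fourier n t := by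
  rw [fourier_apply, fourier_apply, fourier_apply, smul_add, AddCircle.toCircle_add,
    Circle.coe_mul]

theorem fourier_apply_nsmul (n : ℤ) (j : ℕ) (t : UnitAddCircle) :
    (fourier n (j • t) : ℂ) = (fourier n t : ℂ) ^ j := by
  rw [fourier_apply, fourier_apply, smul_comm, AddCircle.toCircle_nsmul, Circle.coe_pow]

/-- The Birkhoff sum of `f` over the rotation by `x`. -/
noncomputable def rotSum (x : UnitAddCircle) (f : UnitAddCircle → ℝ) (q : ℕ) (t : UnitAddCircle) :
    ℝ :=
  ∑ j ∈ Finset.range q, f (t + j • x)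

theorem HasFourierDecay.hasSum_rotSum {f : UnitAddCircle → ℝ} {c : ℤ → ℂ} {C r : ℝ}
    (h : HasFourierDecay f c C r) (x : UnitAddCircle) (q : ℕ) (t : UnitAddCircle) :
    HasSum (fun n => c n * fourier n t * expSum x q n) (rotSum x f q t : ℂ) := by
  have h1 := hasSum_sum (s := Finset.range q) fun j _ => h.hasSum (t + j • x)
  have h2 : ((rotSum x f q t : ℝ) : ℂ) = ∑ j ∈ Finset.range q, (f (t + j • x) : ℂ) := by
    simp [rotSum]
  rw [h2]
  convert! h1 using 2 with n
  rw [expSum, Finset.mul_sum]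
  refine Finset.sum_congr rfl fun j _ => ?_
  rw [fourier_apply_add, fourier_apply_nsmul, mul_assoc]

theorem HasFourierDecay.abs_rotSum_sub_le {f : UnitAddCircle → ℝ} {c : ℤ → ℂ} {C r : ℝ}
    (h : HasFourierDecay f c C r) {x : UnitAddCircle} {q : ℕ}
    (hs : Summable (expFn x q r)) (t : UnitAddCircle) :
    |rotSum x f q t - q * (c 0).re| ≤ C * ∑' n, expFn x q r n := by
  have h1 := (h.hasSum_rotSum x q t).sub (hasSum_ite_eq (0 : ℤ) ((q : ℂ) * c 0))
  have h2 : ‖(rotSum x f q t : ℂ) - q * c 0‖ ≤ C * ∑' n, expFn x q r n := by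
    rw [← h1.tsum_eq]
    refine tsum_of_norm_bounded (hs.hasSum.mul_left C) fun n => ?_
    rcases eq_or_ne n 0 with rfl | hn
    · have : expSum x q 0 = q := by simp [expSum]
      rw [if_pos rfl, this]
      have h3 := expFn_nonneg x q r 0
      have h4 := h.nonneg
      have h5 : c 0 * fourier 0 t * (q : ℂ) - q * c 0 = 0 := by
        rw [fourier_zero]; ring
      rw [h5, norm_zero]
      positivity
    · rw [if_neg hn, sub_zero, norm_mul, norm_mul, norm_fourier_eq_one, mul_one, expFn, ← mul_assoc]
      gcongr
      exact h.bound n hn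
  refine le_trans ?_ h2
  have := Complex.abs_re_le_norm ((rotSum x f q t : ℂ) - q * c 0)
  simpa using this

/-! ### Double Birkhoff sums. -/

/-- The double Birkhoff sum `∑_{i < j < q} f (t + i x) * g (t + j x)`. -/
noncomputable def doubleRotSum (x : UnitAddCircle) (f g : UnitAddCircle → ℝ) (q : ℕ)
    (t : UnitAddCircle) : ℝ :=
  ∑ j ∈ Finset.range q, rotSum x f j t * g (t + j • x)

theorem hasSum_prod_of_summable_norm {a b : ℤ → ℂ} {A B : ℂ} (ha : HasSum a A) (hb : HasSum b B) :
    HasSum (fun p : ℤ × ℤ => a p.1 * b p.2) (A * B) := by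
  have hs : Summable fun p : ℤ × ℤ => a p.1 * b p.2 :=
    summable_mul_of_summable_norm ha.summable.norm hb.summable.norm
  exact ha.mul hb hs

theorem HasFourierDecay.hasSum_doubleRotSum {f g : UnitAddCircle → ℝ} {c d : ℤ → ℂ} {C D r : ℝ}
    (hf : HasFourierDecay f c C r) (hg : HasFourierDecay g d D r) (x : UnitAddCircle) (q : ℕ)
    (t : UnitAddCircle) :
    HasSum (fun p : ℤ × ℤ => c p.1 * d p.2 * fourier (p.1 + p.2) t *
      doubleGeom (fourier p.1 x) (fourier p.2 x) q) (doubleRotSum x f g q t : ℂ) := by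
  have h0 : ∀ i j : ℕ, HasSum (fun p : ℤ × ℤ =>
      (c p.1 * fourier p.1 (t + i • x)) * (d p.2 * fourier p.2 (t + j • x)))
      ((f (t + i • x) : ℂ) * (g (t + j • x) : ℂ)) := fun i j => by
    have h := hasSum_prod_of_summable_norm (hf.hasSum (t + i • x)) (hg.hasSum (t + j • x))
    exact h
  have h2 : ((doubleRotSum x f g q t : ℝ) : ℂ) = ∑ j ∈ Finset.range q, ∑ i ∈ Finset.range j,
      (f (t + i • x) : ℂ) * (g (t + j • x) : ℂ) := by
    simp [doubleRotSum, rotSum, Finset.sum_mul]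
  rw [h2]
  have h3 : (fun p : ℤ × ℤ => c p.1 * d p.2 * fourier (p.1 + p.2) t *
      doubleGeom (fourier p.1 x) (fourier p.2 x) q) = fun p : ℤ × ℤ =>
      ∑ j ∈ Finset.range q, ∑ i ∈ Finset.range j,
        (c p.1 * fourier p.1 (t + i • x)) * (d p.2 * fourier p.2 (t + j • x)) := by
    funext p
    rw [doubleGeom, Finset.mul_sum]
    refine Finset.sum_congr rfl fun j _ => ?_
    rw [Finset.sum_mul, Finset.mul_sum]
    refine Finset.sum_congr rfl fun i _ => ?_
    rw [fourier_apply_add, fourier_apply_add, fourier_apply_nsmul, fourier_apply_nsmul, fourier_add]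
    ring
  rw [h3]
  exact hasSum_sum fun j _ => hasSum_sum fun i _ => h0 i j

/-- Applied with `n` the sum of two frequencies and `k` the larger of them; 8 bounds `2 ^ r`. -/
theorem rpow_neg_le_eight_mul {r : ℝ} (hr : 0 < r) (hr3 : r ≤ 3) {k n : ℤ}
    (hn : n ≠ 0) (h : |n| ≤ 2 * |k|) : |(k : ℝ)| ^ (-r) ≤ 8 * |(n : ℝ)| ^ (-r) := by
  have hn0 : (0 : ℝ) < |(n : ℝ)| := abs_pos.2 (by exact_mod_cast hn)
  have h' : |(n : ℝ)| / 2 ≤ |(k : ℝ)| := by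
    have : |(n : ℝ)| ≤ 2 * |(k : ℝ)| := by exact_mod_cast h
    linarith
  calc |(k : ℝ)| ^ (-r) ≤ (|(n : ℝ)| / 2) ^ (-r) :=
        Real.rpow_le_rpow_of_nonpos (by positivity) h' (by linarith)
    _ = 2 ^ r * |(n : ℝ)| ^ (-r) := by
        rw [Real.div_rpow hn0.le (by norm_num), Real.rpow_neg (by norm_num : (0 : ℝ) ≤ 2)]
        field_simp
    _ ≤ 2 ^ (3 : ℝ) * |(n : ℝ)| ^ (-r) := by gcongr; norm_num
    _ = _ := by norm_num

/-- A frequency above `q / 2` is treated by the trivial bound `q * majorant`. If both are low,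
dividing at the smaller one leaves simple sums at the larger one and at `k + l`, and the weight of
the larger one transfers to `k + l`. Every term is then a product of two one-variable functions, up
to a shear of the index. -/
theorem doubleGeom_weighted_le {x : UnitAddCircle} {q : ℕ} (hq : 1 ≤ q) (hw : WellSpaced x q)
    {r : ℝ} (hr : 0 < r) (hr3 : r ≤ 3) {k l : ℤ} (hk : k ≠ 0) (hl : l ≠ 0) (hkl : k + l ≠ 0) :
    |(k : ℝ)| ^ (-r) * |(l : ℝ)| ^ (-r) * ‖doubleGeom (fourier k x) (fourier l x) q‖ ≤
      headFn x q r k * expFn x q r l + expFn x q r k * headFn x q r l +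
      8 * (headFn x q r k * expFn x q r (k + l) + headFn x q r l * expFn x q r (k + l)) +
      q * (tailFn x q r k * |(l : ℝ)| ^ (-r) + |(k : ℝ)| ^ (-r) * tailFn x q r l) := by
  have hHk := headFn_nonneg x q r k
  have hHl := headFn_nonneg x q r l
  have hEk := expFn_nonneg x q r k
  have hEl := expFn_nonneg x q r l
  have hEkl := expFn_nonneg x q r (k + l)
  have hTk := tailFn_nonneg x q r k
  have hTl := tailFn_nonneg x q r l
  have hwk : 0 ≤ |(k : ℝ)| ^ (-r) := by positivity
  have hwl : 0 ≤ |(l : ℝ)| ^ (-r) := by positivity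
  have hwkl : 0 ≤ |((k + l : ℤ) : ℝ)| ^ (-r) := by positivity
  have hq0 : (0 : ℝ) ≤ q := Nat.cast_nonneg q
  have p1 := mul_nonneg hHk hEl
  have p2 := mul_nonneg hEk hHl
  have p3 := mul_nonneg hHk hEkl
  have p4 := mul_nonneg hHl hEkl
  have p5 := mul_nonneg hq0 (mul_nonneg hTk hwl)
  have p6 := mul_nonneg hq0 (mul_nonneg hwk hTl)
  rcases lt_or_ge (q : ℤ) (2 * |k|) with hlt | hge
  · have h1 : |(k : ℝ)| ^ (-r) * |(l : ℝ)| ^ (-r) * ‖doubleGeom (fourier k x) (fourier l x) q‖ ≤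
        q * (tailFn x q r k * |(l : ℝ)| ^ (-r)) := by
      rw [tailFn, if_pos hlt]
      calc _ ≤ |(k : ℝ)| ^ (-r) * |(l : ℝ)| ^ (-r) * (q * majorant x q k) := by
            gcongr; exact norm_doubleGeom_le_majorant_left x q k l
        _ = _ := by ring
    linarith
  rcases lt_or_ge (q : ℤ) (2 * |l|) with hlt | hge'
  · have h1 : |(k : ℝ)| ^ (-r) * |(l : ℝ)| ^ (-r) * ‖doubleGeom (fourier k x) (fourier l x) q‖ ≤
        q * (|(k : ℝ)| ^ (-r) * tailFn x q r l) := by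
      rw [tailFn, if_pos hlt]
      calc _ ≤ |(k : ℝ)| ^ (-r) * |(l : ℝ)| ^ (-r) * (q * majorant x q l) := by
            gcongr; exact norm_doubleGeom_le_majorant_right x q k l
        _ = _ := by ring
    linarith
  have hkp := hw.norm_pos hq hk hge
  have hlp := hw.norm_pos hq hl hge'
  rcases le_total |k| |l| with hle | hle
  · have hc : |k + l| ≤ 2 * |l| := by have := abs_add_le k l; omega
    have h1 := norm_zsmul_mul_norm_doubleGeom_left x q k l
    have h2 := rpow_neg_le_eight_mul hr hr3 hkl hc
    have h3 : ‖doubleGeom (fourier k x) (fourier l x) q‖ ≤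
        (‖expSum x q (k + l)‖ + ‖expSum x q l‖) / ‖k • x‖ := by
      rw [le_div_iff₀ hkp, mul_comm]; exact h1
    have h4 : |(k : ℝ)| ^ (-r) * |(l : ℝ)| ^ (-r) * ‖doubleGeom (fourier k x) (fourier l x) q‖ ≤
        8 * (headFn x q r k * expFn x q r (k + l)) + headFn x q r k * expFn x q r l := by
      calc _ ≤ |(k : ℝ)| ^ (-r) * |(l : ℝ)| ^ (-r) *
            ((‖expSum x q (k + l)‖ + ‖expSum x q l‖) / ‖k • x‖) := by gcongr
        _ = (|(k : ℝ)| ^ (-r) / ‖k • x‖) * (|(l : ℝ)| ^ (-r) * ‖expSum x q (k + l)‖) +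
            (|(k : ℝ)| ^ (-r) / ‖k • x‖) * (|(l : ℝ)| ^ (-r) * ‖expSum x q l‖) := by ring
        _ ≤ (|(k : ℝ)| ^ (-r) / ‖k • x‖) *
            (8 * |((k + l : ℤ) : ℝ)| ^ (-r) * ‖expSum x q (k + l)‖) +
            (|(k : ℝ)| ^ (-r) / ‖k • x‖) * (|(l : ℝ)| ^ (-r) * ‖expSum x q l‖) := by gcongr
        _ = _ := by rw [headFn, if_pos ⟨hk, hge⟩, expFn, expFn]; ring
    linarith
  · have hc : |k + l| ≤ 2 * |k| := by have := abs_add_le k l; omega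
    have h1 := norm_zsmul_mul_norm_doubleGeom_right x q k l
    have h2 := rpow_neg_le_eight_mul hr hr3 hkl hc
    have h3 : ‖doubleGeom (fourier k x) (fourier l x) q‖ ≤
        (‖expSum x q (k + l)‖ + ‖expSum x q k‖) / ‖l • x‖ := by
      rw [le_div_iff₀ hlp, mul_comm]; exact h1
    have h4 : |(k : ℝ)| ^ (-r) * |(l : ℝ)| ^ (-r) * ‖doubleGeom (fourier k x) (fourier l x) q‖ ≤
        8 * (headFn x q r l * expFn x q r (k + l)) + expFn x q r k * headFn x q r l := by
      calc _ ≤ |(k : ℝ)| ^ (-r) * |(l : ℝ)| ^ (-r) *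
            ((‖expSum x q (k + l)‖ + ‖expSum x q k‖) / ‖l • x‖) := by gcongr
        _ = (|(l : ℝ)| ^ (-r) / ‖l • x‖) * (|(k : ℝ)| ^ (-r) * ‖expSum x q (k + l)‖) +
            (|(l : ℝ)| ^ (-r) / ‖l • x‖) * (|(k : ℝ)| ^ (-r) * ‖expSum x q k‖) := by ring
        _ ≤ (|(l : ℝ)| ^ (-r) / ‖l • x‖) *
            (8 * |((k + l : ℤ) : ℝ)| ^ (-r) * ‖expSum x q (k + l)‖) +
            (|(l : ℝ)| ^ (-r) / ‖l • x‖) * (|(k : ℝ)| ^ (-r) * ‖expSum x q k‖) := by gcongr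
        _ = _ := by rw [headFn, if_pos ⟨hl, hge'⟩, expFn, expFn]; ring
    linarith

theorem hasSum_mul_prod {a b : ℤ → ℝ} (ha : Summable a) (hb : Summable b) (ha0 : ∀ n, 0 ≤ a n)
    (hb0 : ∀ n, 0 ≤ b n) :
    HasSum (fun p : ℤ × ℤ => a p.1 * b p.2) ((∑' n, a n) * ∑' n, b n) :=
  ha.hasSum.mul hb.hasSum (ha.mul_of_nonneg hb ha0 hb0)

theorem hasSum_mul_prod_add_left {a b : ℤ → ℝ} (ha : Summable a) (hb : Summable b)
    (ha0 : ∀ n, 0 ≤ a n) (hb0 : ∀ n, 0 ≤ b n) :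
    HasSum (fun p : ℤ × ℤ => a p.1 * b (p.1 + p.2)) ((∑' n, a n) * ∑' n, b n) := by
  exact (Equiv.hasSum_iff (⟨fun p => (p.1, p.1 + p.2), fun p => (p.1, p.2 - p.1),
    fun p => by simp, fun p => by simp⟩ : ℤ × ℤ ≃ ℤ × ℤ)).2 (hasSum_mul_prod ha hb ha0 hb0)

theorem hasSum_mul_prod_add_right {a b : ℤ → ℝ} (ha : Summable a) (hb : Summable b)
    (ha0 : ∀ n, 0 ≤ a n) (hb0 : ∀ n, 0 ≤ b n) :
    HasSum (fun p : ℤ × ℤ => a p.2 * b (p.1 + p.2)) ((∑' n, a n) * ∑' n, b n) := by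
  have h := (Equiv.hasSum_iff (Equiv.prodComm ℤ ℤ)).2 (hasSum_mul_prod_add_left ha hb ha0 hb0)
  convert! h using 2 with p
  simp [add_comm]

/-- Zero means remove the pairs with `k = 0` or `l = 0`, and `β` absorbs those with `k + l = 0`. The
rest is majorized by summable products: 18 counts two plain products and two sheared ones with
weight 8. -/
theorem HasFourierDecay.exists_abs_doubleRotSum_sub_le {f g : UnitAddCircle → ℝ} {c d : ℤ → ℂ}
    {C D r : ℝ} (hf : HasFourierDecay f c C r) (hg : HasFourierDecay g d D r) (hc0 : c 0 = 0)
    (hd0 : d 0 = 0) {x : UnitAddCircle} {q : ℕ} (hq : 1 ≤ q) (hw : WellSpaced x q) (hr : 1 < r)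
    (hr3 : r ≤ 3) (hE : Summable (expFn x q r)) (hT : Summable (tailFn x q r)) :
    ∃ β : ℝ, ∀ t, |doubleRotSum x f g q t - β| ≤
      C * D * (18 * ((∑' n, headFn x q r n) * ∑' n, expFn x q r n) +
        2 * (q * ((∑' n, tailFn x q r n) * ∑' n : ℤ, |(n : ℝ)| ^ (-r)))) := by
  classical
  have hH := (headFn_sum_le x q r).1
  have hW := summable_int_rpow_neg hr
  have hH0 := headFn_nonneg x q r
  have hE0 := expFn_nonneg x q r
  have hT0 := tailFn_nonneg x q r
  have hW0 : ∀ n : ℤ, 0 ≤ |(n : ℝ)| ^ (-r) := fun n => by positivity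
  have s1 := hasSum_mul_prod hH hE hH0 hE0
  have s2 := hasSum_mul_prod hE hH hE0 hH0
  have s3 := hasSum_mul_prod_add_left hH hE hH0 hE0
  have s4 := hasSum_mul_prod_add_right hH hE hH0 hE0
  have s5 := hasSum_mul_prod hT hW hT0 hW0
  have s6 := hasSum_mul_prod hW hT hW0 hT0
  have S := ((((s1.add s2).add ((s3.add s4).mul_left 8)).add
    ((s5.add s6).mul_left (q : ℝ))).mul_left (C * D))
  set z : UnitAddCircle → ℤ × ℤ → ℂ := fun t p => c p.1 * d p.2 * fourier (p.1 + p.2) t *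
      doubleGeom (fourier p.1 x) (fourier p.2 x) q with hz
  have hCD : 0 ≤ C * D := mul_nonneg hf.nonneg hg.nonneg
  have hbound : ∀ t p, ‖if p.1 + p.2 = 0 then 0 else z t p‖ ≤ C * D *
      (headFn x q r p.1 * expFn x q r p.2 + expFn x q r p.1 * headFn x q r p.2 +
      8 * (headFn x q r p.1 * expFn x q r (p.1 + p.2) +
        headFn x q r p.2 * expFn x q r (p.1 + p.2)) +
      q * (tailFn x q r p.1 * |(p.2 : ℝ)| ^ (-r) + |(p.1 : ℝ)| ^ (-r) * tailFn x q r p.2)) := by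
    rintro t ⟨k, l⟩
    have hrhs : 0 ≤ C * D *
      (headFn x q r k * expFn x q r l + expFn x q r k * headFn x q r l +
      8 * (headFn x q r k * expFn x q r (k + l) + headFn x q r l * expFn x q r (k + l)) +
      q * (tailFn x q r k * |(l : ℝ)| ^ (-r) + |(k : ℝ)| ^ (-r) * tailFn x q r l)) := by
      have := hH0 k; have := hH0 l; have := hE0 k; have := hE0 l; have := hE0 (k + l)
      have := hT0 k; have := hT0 l
      positivity
    split_ifs with h0
    · rw [norm_zero]; exact hrhs
    rcases eq_or_ne k 0 with rfl | hk
    · simp only [hz, hc0, zero_mul, norm_zero]; exact hrhs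
    rcases eq_or_ne l 0 with rfl | hl
    · simp only [hz, hd0, mul_zero, zero_mul, norm_zero]; exact hrhs
    refine le_trans ?_ (mul_le_mul_of_nonneg_left
      (doubleGeom_weighted_le hq hw (by linarith) hr3 hk hl h0) hCD)
    simp only [hz]
    rw [norm_mul, norm_mul, norm_mul, norm_fourier_eq_one, mul_one]
    calc ‖c k‖ * ‖d l‖ * ‖doubleGeom (fourier k x) (fourier l x) q‖
        ≤ (C * |(k : ℝ)| ^ (-r)) * (D * |(l : ℝ)| ^ (-r)) *
          ‖doubleGeom (fourier k x) (fourier l x) q‖ := by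
          gcongr
          · exact mul_nonneg hf.nonneg (hW0 k)
          · exact hf.bound k hk
          · exact hg.bound l hl
      _ = _ := by ring
  have hdiag : ∀ t p, (z t p - if p.1 + p.2 = 0 then 0 else z t p) =
      if p.1 + p.2 = 0 then c p.1 * d p.2 * doubleGeom (fourier p.1 x) (fourier p.2 x) q else 0 := by
    rintro t ⟨k, l⟩
    by_cases h0 : k + l = 0
    · simp only [h0, if_true, hz, fourier_zero, mul_one, sub_zero]
    · simp only [h0, if_false, sub_self]
  -- On the antidiagonal the character `fourier (k + l) t` is 1, so this sum does not depend on `t`.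
  refine ⟨(∑' p : ℤ × ℤ, if p.1 + p.2 = 0 then
    c p.1 * d p.2 * doubleGeom (fourier p.1 x) (fourier p.2 x) q else 0).re, fun t => ?_⟩
  have hsz := hf.hasSum_doubleRotSum hg x q t
  have hso : Summable fun p : ℤ × ℤ => if p.1 + p.2 = 0 then 0 else z t p :=
    Summable.of_norm_bounded S.summable (hbound t)
  have hd := hsz.sub hso.hasSum
  rw [funext (hdiag t)] at hd
  rw [hd.tsum_eq, Complex.sub_re, Complex.ofReal_re]
  have h1 := tsum_of_norm_bounded S (hbound t)
  have h2 := (Complex.abs_re_le_norm _).trans h1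
  refine le_trans (le_of_eq ?_) (h2.trans (le_of_eq ?_))
  · congr 1; ring
  · ring

/-- At a good denominator `q`, the Heisenberg cocycle of length `q` is uniformly close to a central
constant. -/
theorem exists_cocycle_bound {φ η ψ : UnitAddCircle → ℝ} {c d e : ℤ → ℂ} {Cφ Cη Cψ ε : ℝ}
    (hε : 0 < ε) (hε1 : ε ≤ 1 / 2) (hφ : HasFourierDecay φ c Cφ (2 + 2 * ε))
    (hη : HasFourierDecay η d Cη (2 + 2 * ε)) (hψ : HasFourierDecay ψ e Cψ (1 + ε))
    (hc0 : c 0 = 0) (hd0 : d 0 = 0) {C₀ : ℝ} (hC₀ : 0 ≤ C₀) :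
    ∃ C : ℝ, 1 ≤ C ∧ ∀ (x : UnitAddCircle) (q : ℕ) (Q : ℝ), 1 ≤ q → WellSpaced x q → 0 < Q →
      ‖q • x‖ ≤ 1 / Q → HeadBound x ε C₀ q Q → ∃ β : ℝ, ∀ t,
        |rotSum x φ q t| ≤ C * (q : ℝ) ^ (-(ε / 5)) ∧
        |rotSum x η q t| ≤ C * (q : ℝ) ^ (-(ε / 5)) ∧
        |rotSum x ψ q t + doubleRotSum x φ η q t - β| ≤ C * (q : ℝ) ^ (-(ε / 5)) := by
  obtain ⟨C₁, hC₁, h₁⟩ := expFn_sum_le (r := 1 + ε) (l := ε / 2) (by linarith) (by linarith)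
  obtain ⟨C₂, hC₂, h₂⟩ := expFn_sum_le (r := 2 + 2 * ε) (l := ε / 2) (by linarith) (by linarith)
  obtain ⟨C₃, hC₃, h₃⟩ := tail_sum_le (s := 2 + 2 * ε) (l := ε / 2) (by linarith) (by linarith)
  set W : ℝ := ∑' n : ℤ, |(n : ℝ)| ^ (-(2 + 2 * ε)) with hW
  set ζ : ℝ := ∑' n : ℕ, (n : ℝ) ^ (-(2 + 2 * ε)) with hζ
  have hW0 : 0 ≤ W := tsum_nonneg fun n => by positivity
  have hζ0 : 0 ≤ ζ := tsum_nonneg fun n => by positivity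
  have hCφ := hφ.nonneg
  have hCη := hη.nonneg
  have hCψ := hψ.nonneg
  set E : ℝ := 4 * C₀ + C₁ with hE
  set F : ℝ := 18 * (8 * C₀ + 4 * ζ * C₂) + 2 * (C₃ * W) with hF
  have hE0 : 0 ≤ E := by positivity
  have hF0 : 0 ≤ F := by positivity
  refine ⟨1 + Cφ * E + Cη * E + Cψ * E + Cφ * Cη * F, ?_, fun x q Q hq hw hQ hqQ hb => ?_⟩
  · have : 0 ≤ Cφ * E + Cη * E + Cψ * E + Cφ * Cη * F := by positivity
    linarith
  have hq' : (1 : ℝ) ≤ q := by exact_mod_cast hq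
  set y : ℝ := (q : ℝ) ^ (-(ε / 5)) with hy
  have hy0 : 0 ≤ y := by positivity
  obtain ⟨hs₁, hb₁⟩ := h₁ x q Q hq hw hQ hqQ
  obtain ⟨hs₂, hb₂⟩ := h₂ x q Q hq hw hQ hqQ
  obtain ⟨hs₃, hb₃⟩ := h₃ x q hq hw
  have hle : ∀ a : ℝ, a ≤ -(ε / 5) → (q : ℝ) ^ a ≤ y := fun a ha =>
    Real.rpow_le_rpow_of_exponent_le hq' ha
  have b1 : ∑' n, expFn x q (1 + ε) n ≤ E * y := by
    refine hb₁.trans ?_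
    rw [show 1 + ε - 1 = ε by ring]
    have e1 := hb.1
    have e2 : C₁ * (q : ℝ) ^ (1 - (1 + ε) + ε / 2) ≤ C₁ * y := by
      gcongr; exact hle _ (by linarith)
    rw [hE, add_mul]
    linarith
  -- Decay of order `2 + 2ε` compensates the extra factor `q` of the double sum: the exponents add
  -- up to `-3ε/2`.
  have b3 : (q : ℝ) * ((∑' n, tailFn x q (2 + 2 * ε) n) * W) ≤ C₃ * W * y := by
    calc (q : ℝ) * ((∑' n, tailFn x q (2 + 2 * ε) n) * W)
        ≤ q * ((C₃ * (q : ℝ) ^ (1 - (2 + 2 * ε) + ε / 2)) * W) := by gcongr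
      _ = C₃ * W * ((q : ℝ) ^ (1 : ℝ) * (q : ℝ) ^ (1 - (2 + 2 * ε) + ε / 2)) := by
        rw [Real.rpow_one]; ring
      _ ≤ C₃ * W * y := by
        rw [← Real.rpow_add (by positivity)]
        gcongr
        exact hle _ (by linarith)
  -- The second half of `HeadBound` handles the small divisor part of the second factor; against its
  -- high-frequency remainder the bound `O(q)` for the first factor is enough.
  have b2 : (∑' n, headFn x q (2 + 2 * ε) n) * ∑' n, expFn x q (2 + 2 * ε) n ≤
      (8 * C₀ + 4 * ζ * C₂) * y := by
    have g0 := headSum_nonneg x q (2 + 2 * ε)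
    have g1 := (headFn_sum_le x q (2 + 2 * ε)).2
    have g2 : headSum x q (2 + 2 * ε) ≤ 2 * ζ * q := hw.headSum_le_mul hq (by linarith)
    have g3 := hb.2
    rw [show 2 + 2 * ε - 1 = 1 + 2 * ε by ring] at hb₂
    have g4 : 0 ≤ ∑' n, expFn x q (2 + 2 * ε) n := tsum_nonneg (expFn_nonneg x q _)
    calc _ ≤ (2 * headSum x q (2 + 2 * ε)) * (4 * (headSum x q (1 + 2 * ε) / Q) +
          C₂ * (q : ℝ) ^ (1 - (2 + 2 * ε) + ε / 2)) := by gcongr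
      _ = 8 * (headSum x q (2 + 2 * ε) * (headSum x q (1 + 2 * ε) / Q)) +
          2 * C₂ * (headSum x q (2 + 2 * ε) * (q : ℝ) ^ (1 - (2 + 2 * ε) + ε / 2)) := by ring
      _ ≤ 8 * (C₀ * y) +
          2 * C₂ * ((2 * ζ * q) * (q : ℝ) ^ (1 - (2 + 2 * ε) + ε / 2)) := by gcongr
      _ = 8 * (C₀ * y) +
          4 * ζ * C₂ * ((q : ℝ) ^ (1 : ℝ) * (q : ℝ) ^ (1 - (2 + 2 * ε) + ε / 2)) := by
        rw [Real.rpow_one]; ring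
      _ ≤ 8 * (C₀ * y) + 4 * ζ * C₂ * y := by
        rw [← Real.rpow_add (by positivity)]
        gcongr
        exact hle _ (by linarith)
      _ = _ := by ring
  obtain ⟨β, hβ⟩ := hφ.exists_abs_doubleRotSum_sub_le hη hc0 hd0 hq hw (by linarith)
    (by linarith) hs₂ hs₃
  have n1 : 0 ≤ Cφ * E * y := by positivity
  have n2 : 0 ≤ Cη * E * y := by positivity
  have n3 : 0 ≤ Cψ * E * y := by positivity
  have n4 : 0 ≤ Cφ * Cη * F * y := by positivity
  have hexp : (1 + Cφ * E + Cη * E + Cψ * E + Cφ * Cη * F) * y =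
    y + Cφ * E * y + Cη * E * y + Cψ * E * y + Cφ * Cη * F * y := by ring
  rw [hexp]
  refine ⟨q * (e 0).re + β, fun t => ⟨?_, ?_, ?_⟩⟩
  · have h := (hφ.mono (show 1 + ε ≤ 2 + 2 * ε by linarith)).abs_rotSum_sub_le hs₁ t
    rw [hc0, Complex.zero_re, mul_zero, sub_zero] at h
    have h' : Cφ * ∑' n, expFn x q (1 + ε) n ≤ Cφ * (E * y) := by gcongr
    linarith
  · have h := (hη.mono (show 1 + ε ≤ 2 + 2 * ε by linarith)).abs_rotSum_sub_le hs₁ t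
    rw [hd0, Complex.zero_re, mul_zero, sub_zero] at h
    have h' : Cη * ∑' n, expFn x q (1 + ε) n ≤ Cη * (E * y) := by gcongr
    linarith
  · have h := hψ.abs_rotSum_sub_le hs₁ t
    have h' : Cψ * ∑' n, expFn x q (1 + ε) n ≤ Cψ * (E * y) := by gcongr
    have k := hβ t
    have k' : Cφ * Cη * (18 * ((∑' n, headFn x q (2 + 2 * ε) n) *
        ∑' n, expFn x q (2 + 2 * ε) n) + 2 * (q * ((∑' n, tailFn x q (2 + 2 * ε) n) * W))) ≤
        Cφ * Cη * (F * y) := by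
      gcongr
      rw [hF]
      linarith
    have tri := abs_add_le (rotSum x ψ q t - q * (e 0).re) (doubleRotSum x φ η q t - β)
    rw [show rotSum x ψ q t - q * (e 0).re + (doubleRotSum x φ η q t - β) =
      rotSum x ψ q t + doubleRotSum x φ η q t - (q * (e 0).re + β) by ring] at tri
    linarith

/-! ### Regular functions on the nilmanifold -/

namespace Heis

/-- A subadditive gauge on the Heisenberg group. -/
noncomputable def gauge (g : Heis) : ℝ := max (max |g.a| |g.b|) √|g.c|

theorem gauge_nonneg (g : Heis) : 0 ≤ g.gauge := le_max_of_le_right (Real.sqrt_nonneg _)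

theorem gauge_le {g : Heis} {τ : ℝ} (hτ : 0 ≤ τ) (ha : |g.a| ≤ τ) (hb : |g.b| ≤ τ)
    (hc : |g.c| ≤ τ ^ 2) : g.gauge ≤ τ :=
  max_le (max_le ha hb) ((Real.sqrt_le_left hτ).2 hc)

theorem abs_a_le_gauge (g : Heis) : |g.a| ≤ g.gauge := (le_max_left _ _).trans (le_max_left _ _)
theorem abs_b_le_gauge (g : Heis) : |g.b| ≤ g.gauge := (le_max_right _ _).trans (le_max_left _ _)
theorem abs_c_le_gauge_sq (g : Heis) : |g.c| ≤ g.gauge ^ 2 :=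
  (Real.sqrt_le_left g.gauge_nonneg).1 (le_max_right _ _)

/-- The square root on the central coordinate is what makes this work: the cross term `g.a * h.b`
fits into the square of the sum of the gauges. -/
theorem gauge_mul_le (g h : Heis) : (g * h).gauge ≤ g.gauge + h.gauge := by
  have hg := g.gauge_nonneg
  have hh := h.gauge_nonneg
  refine gauge_le (by positivity) ?_ ?_ ?_
  · exact (abs_add_le _ _).trans (add_le_add g.abs_a_le_gauge h.abs_a_le_gauge)
  · exact (abs_add_le _ _).trans (add_le_add g.abs_b_le_gauge h.abs_b_le_gauge)
  · rw [mul_c]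
    have h1 : |g.a * h.b| ≤ g.gauge * h.gauge := by
      rw [abs_mul]; exact mul_le_mul g.abs_a_le_gauge h.abs_b_le_gauge (abs_nonneg _) hg
    have h2 := abs_add_le (g.c + h.c) (g.a * h.b)
    have h3 := abs_add_le g.c h.c
    nlinarith [g.abs_c_le_gauge_sq, h.abs_c_le_gauge_sq, mul_nonneg hg hh]

@[simp] theorem gauge_one : gauge 1 = 0 := by simp [gauge]

theorem continuous_gauge : Continuous gauge :=
  (continuous_a.abs.max continuous_b.abs).max continuous_c.abs.sqrt

theorem isClosed_lattice : IsClosed (lattice : Set Heis) := by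
  have h : (lattice : Set Heis) = {g | g.a ∈ Set.range ((↑) : ℤ → ℝ)} ∩
      {g | g.c ∈ Set.range ((↑) : ℤ → ℝ)} ∩ {g | g.b ∈ Set.range ((↑) : ℤ → ℝ)} := by
    ext g
    constructor
    · rintro ⟨k, m, l, rfl⟩
      exact ⟨⟨⟨k, rfl⟩, ⟨m, rfl⟩⟩, ⟨l, rfl⟩⟩
    · rintro ⟨⟨⟨k, hk⟩, ⟨m, hm⟩⟩, ⟨l, hl⟩⟩
      exact ⟨k, m, l, by ext <;> simp [*]⟩
  have hc := Int.isClosedEmbedding_coe_real.isClosed_range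
  rw [h]
  exact ((hc.preimage continuous_a).inter (hc.preimage continuous_c)).inter
    (hc.preimage continuous_b)

theorem tendsto_one_of_tendsto_gauge {u : ℕ → Heis}
    (hu : Tendsto (fun n => (u n).gauge) atTop (𝓝 0)) : Tendsto u atTop (𝓝 1) := by
  have ha : Tendsto (fun n => (u n).a) atTop (𝓝 0) :=
    squeeze_zero_norm (fun n => (u n).abs_a_le_gauge) hu
  have hb : Tendsto (fun n => (u n).b) atTop (𝓝 0) :=
    squeeze_zero_norm (fun n => (u n).abs_b_le_gauge) hu
  have hc : Tendsto (fun n => (u n).c) atTop (𝓝 0) :=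
    squeeze_zero_norm (fun n => (u n).abs_c_le_gauge_sq) (by simpa using hu.pow 2)
  have hm : Continuous (fun p : ℝ × ℝ × ℝ => (⟨p.1, p.2.1, p.2.2⟩ : Heis)) :=
    continuous_mk (by fun_prop) (by fun_prop) (by fun_prop)
  exact (hm.tendsto (0, 0, 0)).comp (ha.prodMk_nhds (hc.prodMk_nhds hb))

/-- The gauge distance from the orbit `Γ g` to `w`. -/
noncomputable def orbitDist (w g : Heis) : ℝ := ⨅ γ : lattice, gauge ((γ * g)⁻¹ * w)

theorem bddBelow_orbitDist (w g : Heis) :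
    BddBelow (Set.range fun γ : lattice => gauge ((γ * g)⁻¹ * w)) :=
  ⟨0, by rintro _ ⟨γ, rfl⟩; exact gauge_nonneg _⟩

theorem orbitDist_nonneg (w g : Heis) : 0 ≤ orbitDist w g := le_ciInf fun _ => gauge_nonneg _

theorem orbitDist_self (w : Heis) : orbitDist w w = 0 := by
  refine le_antisymm ((ciInf_le (bddBelow_orbitDist w w) 1).trans ?_) (orbitDist_nonneg w w)
  simp

theorem orbitDist_lattice_mul (w g : Heis) (γ : lattice) :
    orbitDist w (γ * g) = orbitDist w g := by
  refine (Equiv.mulRight γ).iInf_congr fun δ => ?_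
  simp [mul_assoc]

theorem orbitDist_mul_le (w g h : Heis) : orbitDist w (g * h) ≤ orbitDist w g + gauge h⁻¹ := by
  rw [← sub_le_iff_le_add]
  refine le_ciInf fun γ => ?_
  rw [sub_le_iff_le_add, add_comm]
  refine (ciInf_le (bddBelow_orbitDist w (g * h)) γ).trans ?_
  refine le_trans (le_of_eq ?_) (gauge_mul_le _ _)
  congr 1
  simp [mul_assoc]

theorem abs_orbitDist_mul_sub_le (w g h : Heis) :
    |orbitDist w (g * h) - orbitDist w g| ≤ gauge h + gauge h⁻¹ := by
  have h1 := orbitDist_mul_le w g h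
  have h2 := orbitDist_mul_le w (g * h) h⁻¹
  rw [mul_inv_cancel_right, inv_inv] at h2
  have := gauge_nonneg h
  have := gauge_nonneg h⁻¹
  rw [abs_le]
  constructor <;> linarith

theorem continuous_orbitDist (w : Heis) : Continuous (orbitDist w) := by
  rw [continuous_iff_continuousAt]
  intro g
  have h1 : Tendsto (fun g' => gauge (g⁻¹ * g') + gauge (g⁻¹ * g')⁻¹) (𝓝 g) (𝓝 0) := by
    have hc : Continuous (fun g' => gauge (g⁻¹ * g') + gauge (g⁻¹ * g')⁻¹) :=
      (continuous_gauge.comp (continuous_const.mul continuous_id)).add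
        (continuous_gauge.comp (continuous_const.mul continuous_id).inv)
    simpa using hc.tendsto g
  rw [ContinuousAt, tendsto_iff_norm_sub_tendsto_zero]
  refine squeeze_zero (fun _ => norm_nonneg _) (fun g' => ?_) h1
  have := abs_orbitDist_mul_sub_le w g (g⁻¹ * g')
  rwa [mul_inv_cancel_left] at this

/-- Lattice translates of `g` approach `w`, and the lattice is closed. -/
theorem mul_inv_mem_lattice_of_orbitDist_eq_zero {w g : Heis} (h : orbitDist w g = 0) :
    g * w⁻¹ ∈ lattice := by
  have hex : ∀ n : ℕ, ∃ γ : lattice, gauge ((γ * g)⁻¹ * w) < 1 / ((n : ℝ) + 1) := fun n =>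
    exists_lt_of_ciInf_lt (by rw [← orbitDist, h]; positivity)
  choose γ hγ using hex
  have h1 : Tendsto (fun n => gauge ((γ n * g)⁻¹ * w)) atTop (𝓝 0) :=
    squeeze_zero (fun _ => gauge_nonneg _) (fun n => (hγ n).le)
      tendsto_one_div_add_atTop_nhds_zero_nat
  have h2 := tendsto_one_of_tendsto_gauge h1
  have h3 : Tendsto (fun n => g * ((γ n * g)⁻¹ * w) * w⁻¹) atTop (𝓝 (g * 1 * w⁻¹)) :=
    (tendsto_const_nhds.mul h2).mul tendsto_const_nhds
  rw [mul_one] at h3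
  refine isClosed_lattice.mem_of_tendsto h3 (Eventually.of_forall fun n => ?_)
  have : g * ((γ n * g)⁻¹ * w) * w⁻¹ = ((γ n)⁻¹ : lattice) := by
    simp [mul_assoc]
  rw [this]
  exact SetLike.coe_mem _

end Heis

namespace HeisNil

theorem mk_eq_mk_iff {g h : Heis} : mk g = mk h ↔ h * g⁻¹ ∈ Heis.lattice := by
  rw [mk, mk, ← QuotientGroup.rightRel_apply]
  exact Quotient.eq

/-- The gauge distance to `Γ w`, as a function on the nilmanifold. -/
noncomputable def distFn (w : Heis) : HeisNil → ℝ :=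
  Quotient.lift (Heis.orbitDist w) fun g h e => by
    have e' : mk g = mk h := Quotient.sound e
    rw [mk_eq_mk_iff] at e'
    have := Heis.orbitDist_lattice_mul w g ⟨h * g⁻¹, e'⟩
    simpa using this.symm

theorem distFn_mk (w g : Heis) : distFn w (mk g) = Heis.orbitDist w g := rfl

theorem continuous_distFn (w : Heis) : Continuous (distFn w) :=
  (Heis.continuous_orbitDist w).quotient_lift _

theorem abs_distFn_rmul_sub_le (w : Heis) (y : HeisNil) (h : Heis) :
    |distFn w (rmul y h) - distFn w y| ≤ h.gauge + h⁻¹.gauge := by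
  obtain ⟨g, rfl⟩ := isOpenQuotientMap_mk.surjective y
  exact Heis.abs_orbitDist_mul_sub_le w g h

theorem eq_mk_of_distFn_eq_zero {w : Heis} {y : HeisNil} (h : distFn w y = 0) : y = mk w := by
  obtain ⟨g, rfl⟩ := isOpenQuotientMap_mk.surjective y
  exact (mk_eq_mk_iff.2 (Heis.mul_inv_mem_lattice_of_orbitDist_eq_zero h)).symm

/-- A central integral element can be moved to the left, where the lattice absorbs it. Hence the
corner entry matters only modulo integers. -/
theorem rmul_mul_central (y : HeisNil) (h : Heis) (k : ℤ) : rmul y (h * ⟨0, k, 0⟩) = rmul y h := by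
  obtain ⟨g, rfl⟩ := isOpenQuotientMap_mk.surjective y
  rw [rmul_mk, rmul_mk]
  refine (mk_eq_mk_iff.2 ⟨0, k, 0, ?_⟩).symm
  rw [mul_inv_eq_iff_eq_mul]
  ext <;> simp
  ring

end HeisNil

/-! ### A dense algebra of Lipschitz functions. -/

/-- The modulus inequality defining regular functions on the phase space. -/
def IsRegularWith (C : ℝ) (f : C(CircleHeis, ℂ)) : Prop :=
  ∀ (t s : UnitAddCircle) (y : HeisNil) (h : Heis),
    ‖f (t + s, HeisNil.rmul y h) - f (t, y)‖ ≤ C * (‖s‖ + h.gauge + h⁻¹.gauge)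

/-- The star algebra of functions that are Lipschitz along right translations. -/
def regularAlgebra : StarSubalgebra ℂ C(CircleHeis, ℂ) where
  carrier := {f | ∃ C : ℝ, 0 ≤ C ∧ IsRegularWith C f}
  mul_mem' := by
    rintro f g ⟨C, hC, hf⟩ ⟨D, hD, hg⟩
    refine ⟨‖f‖ * D + ‖g‖ * C, by positivity, fun t s y h => ?_⟩
    have hp : 0 ≤ ‖s‖ + h.gauge + h⁻¹.gauge := by
      have := h.gauge_nonneg; have := h⁻¹.gauge_nonneg; positivity
    have e : (f * g) (t + s, HeisNil.rmul y h) - (f * g) (t, y) =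
        f (t + s, HeisNil.rmul y h) * (g (t + s, HeisNil.rmul y h) - g (t, y)) +
        g (t, y) * (f (t + s, HeisNil.rmul y h) - f (t, y)) := by
      simp only [ContinuousMap.mul_apply]; ring
    rw [e]
    calc _ ≤ ‖f (t + s, HeisNil.rmul y h)‖ * ‖g (t + s, HeisNil.rmul y h) - g (t, y)‖ +
          ‖g (t, y)‖ * ‖f (t + s, HeisNil.rmul y h) - f (t, y)‖ := by
          rw [← norm_mul, ← norm_mul]; exact norm_add_le _ _
      _ ≤ ‖f‖ * (D * (‖s‖ + h.gauge + h⁻¹.gauge)) + ‖g‖ * (C * (‖s‖ + h.gauge + h⁻¹.gauge)) := by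
          gcongr
          · exact f.norm_coe_le_norm _
          · exact hg t s y h
          · exact g.norm_coe_le_norm _
          · exact hf t s y h
      _ = _ := by ring
  add_mem' := by
    rintro f g ⟨C, hC, hf⟩ ⟨D, hD, hg⟩
    refine ⟨C + D, by positivity, fun t s y h => ?_⟩
    have e : (f + g) (t + s, HeisNil.rmul y h) - (f + g) (t, y) =
        (f (t + s, HeisNil.rmul y h) - f (t, y)) + (g (t + s, HeisNil.rmul y h) - g (t, y)) := by
      simp only [ContinuousMap.add_apply]; ring
    rw [e, add_mul]
    exact (norm_add_le _ _).trans (add_le_add (hf t s y h) (hg t s y h))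
  algebraMap_mem' := fun z => ⟨0, le_rfl, fun t s y h => by simp⟩
  star_mem' := by
    rintro f ⟨C, hC, hf⟩
    refine ⟨C, hC, fun t s y h => ?_⟩
    rw [ContinuousMap.star_apply, ContinuousMap.star_apply, ← star_sub, norm_star]
    exact hf t s y h

theorem mem_regularAlgebra {f : C(CircleHeis, ℂ)} :
    f ∈ regularAlgebra ↔ ∃ C : ℝ, 0 ≤ C ∧ IsRegularWith C f := Iff.rfl

/-- Distance on the circle separates distinct base points, and the gauge distance to one of the two
cosets separates points over the same base point. -/
theorem regularAlgebra_separatesPoints : regularAlgebra.toSubalgebra.SeparatesPoints := by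
  rintro ⟨t₁, y₁⟩ ⟨t₂, y₂⟩ hne
  by_cases ht : t₁ = t₂
  · subst ht
    have hy : y₁ ≠ y₂ := fun h => hne (by rw [h])
    obtain ⟨w, rfl⟩ := HeisNil.isOpenQuotientMap_mk.surjective y₂
    let f : C(CircleHeis, ℂ) := ⟨fun p => (HeisNil.distFn w p.2 : ℂ),
      Complex.continuous_ofReal.comp ((HeisNil.continuous_distFn w).comp continuous_snd)⟩
    refine ⟨f, ⟨f, mem_regularAlgebra.2 ⟨1, zero_le_one, fun t s y h => ?_⟩, rfl⟩, ?_⟩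
    · show ‖((HeisNil.distFn w (HeisNil.rmul y h) : ℝ) : ℂ) - (HeisNil.distFn w y : ℝ)‖ ≤ _
      rw [← Complex.ofReal_sub, Complex.norm_real, one_mul]
      refine (HeisNil.abs_distFn_rmul_sub_le w y h).trans ?_
      linarith [norm_nonneg s]
    · intro he
      have he' : ((HeisNil.distFn w y₁ : ℝ) : ℂ) = (HeisNil.distFn w (HeisNil.mk w) : ℝ) := he
      rw [HeisNil.distFn_mk, Heis.orbitDist_self] at he'
      exact hy (HeisNil.eq_mk_of_distFn_eq_zero (by exact_mod_cast he'))
  · let f : C(CircleHeis, ℂ) := ⟨fun p => ((‖p.1 - t₂‖ : ℝ) : ℂ),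
      Complex.continuous_ofReal.comp (continuous_fst.sub continuous_const).norm⟩
    refine ⟨f, ⟨f, mem_regularAlgebra.2 ⟨1, zero_le_one, fun t s y h => ?_⟩, rfl⟩, ?_⟩
    · show ‖((‖t + s - t₂‖ : ℝ) : ℂ) - ((‖t - t₂‖ : ℝ) : ℂ)‖ ≤ _
      rw [← Complex.ofReal_sub, Complex.norm_real, one_mul]
      have h1 : |‖t + s - t₂‖ - ‖t - t₂‖| ≤ ‖s‖ := by
        have := abs_norm_sub_norm_le (t + s - t₂) (t - t₂)
        rwa [show t + s - t₂ - (t - t₂) = s by abel] at this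
      refine h1.trans ?_
      linarith [h.gauge_nonneg, h⁻¹.gauge_nonneg]
    · intro he
      have he' : ((‖t₁ - t₂‖ : ℝ) : ℂ) = ((‖t₂ - t₂‖ : ℝ) : ℂ) := he
      rw [sub_self, norm_zero] at he'
      have : ‖t₁ - t₂‖ = 0 := by exact_mod_cast he'
      exact ht (sub_eq_zero.1 (norm_eq_zero.1 this))

theorem isLinearlyDense_regularAlgebra :
    IsLinearlyDense (regularAlgebra : Set C(CircleHeis, ℂ)) := by
  have h := ContinuousMap.starSubalgebra_topologicalClosure_eq_top_of_separatesPoints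
    regularAlgebra regularAlgebra_separatesPoints
  have hd : Dense (regularAlgebra : Set C(CircleHeis, ℂ)) := by
    intro f
    have : f ∈ regularAlgebra.topologicalClosure := by rw [h]; trivial
    exact this
  exact hd.mono Submodule.subset_span

/-! ### Iterates of the skew product -/

/-- The fibre element of the `n`-th iterate of the skew product. -/
noncomputable def iterCocycle (x : UnitAddCircle) (φ η ψ : C(UnitAddCircle, ℝ)) (n : ℕ)
    (t : UnitAddCircle) : Heis :=
  ⟨rotSum x φ n t, rotSum x ψ n t + doubleRotSum x φ η n t, rotSum x η n t⟩

theorem iterCocycle_zero (x : UnitAddCircle) (φ η ψ : C(UnitAddCircle, ℝ)) (t : UnitAddCircle) :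
    iterCocycle x φ η ψ 0 t = 1 := by
  ext <;> simp [iterCocycle, rotSum, doubleRotSum]

/-- The cross term of the group law is exactly the next summand of the double Birkhoff sum. -/
theorem iterCocycle_succ (x : UnitAddCircle) (φ η ψ : C(UnitAddCircle, ℝ)) (n : ℕ)
    (t : UnitAddCircle) :
    iterCocycle x φ η ψ (n + 1) t = iterCocycle x φ η ψ n t * cocycle φ η ψ (t + n • x) := by
  ext
  · simp [iterCocycle, rotSum, cocycle, Finset.sum_range_succ]
  · simp only [iterCocycle, rotSum, doubleRotSum, cocycle, Finset.sum_range_succ, Heis.mul_c]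
    ring
  · simp [iterCocycle, rotSum, cocycle, Finset.sum_range_succ]

theorem iterCocycle_add (x : UnitAddCircle) (φ η ψ : C(UnitAddCircle, ℝ)) (m n : ℕ)
    (t : UnitAddCircle) :
    iterCocycle x φ η ψ (m + n) t =
      iterCocycle x φ η ψ m t * iterCocycle x φ η ψ n (t + m • x) := by
  induction n with
  | zero => simp [iterCocycle_zero]
  | succ n ih =>
    rw [← add_assoc, iterCocycle_succ, ih, iterCocycle_succ, mul_assoc, add_smul, add_assoc]

theorem skewProduct_pow_apply (α : ℝ) (φ η ψ : C(UnitAddCircle, ℝ)) (n : ℕ) (t : UnitAddCircle)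
    (y : HeisNil) :
    (skewProduct α φ η ψ ^ n) (t, y) =
      (t + n • (α : UnitAddCircle), HeisNil.rmul y (iterCocycle (α : UnitAddCircle) φ η ψ n t)) := by
  induction n with
  | zero => simp [iterCocycle_zero, HeisNil.rmul_one]
  | succ n ih =>
    rw [pow_succ', Homeomorph.mul_apply, ih, iterCocycle_succ, ← HeisNil.rmul_rmul, succ_nsmul,
      ← add_assoc]
    rfl

/-- Errors add linearly except for the cross terms: the one created at step `J` is at most `J * ρ ^
2`, and these sum to less than the quadratic allowance. -/
theorem iterCocycle_mul_bound {x : UnitAddCircle} {φ η ψ : C(UnitAddCircle, ℝ)} {q : ℕ}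
    {ρ β : ℝ} (hρ : 0 ≤ ρ) (h : ∀ t, |(iterCocycle x φ η ψ q t).a| ≤ ρ ∧
      |(iterCocycle x φ η ψ q t).b| ≤ ρ ∧ |(iterCocycle x φ η ψ q t).c - β| ≤ ρ) (J : ℕ)
    (t : UnitAddCircle) :
    |(iterCocycle x φ η ψ (J * q) t).a| ≤ J * ρ ∧ |(iterCocycle x φ η ψ (J * q) t).b| ≤ J * ρ ∧
      |(iterCocycle x φ η ψ (J * q) t).c - J * β| ≤ J * ρ + (J * ρ) ^ 2 := by
  induction J with
  | zero => simp [iterCocycle_zero]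
  | succ J ih =>
    obtain ⟨ha, hb, hc⟩ := ih
    obtain ⟨ha', hb', hc'⟩ := h (t + (J * q) • x)
    rw [Nat.succ_mul, iterCocycle_add, Heis.mul_a, Heis.mul_b, Heis.mul_c]
    set g := iterCocycle x φ η ψ (J * q) t
    set g' := iterCocycle x φ η ψ q (t + (J * q) • x)
    push_cast
    have h1 : |g.a * g'.b| ≤ (J * ρ) * ρ := by
      rw [abs_mul]; gcongr
    have h2 := abs_add_le g.a g'.a
    have h3 := abs_add_le g.b g'.b
    have h4 : g.c + g'.c + g.a * g'.b - (J + 1) * β =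
      (g.c - J * β) + (g'.c - β) + g.a * g'.b := by ring
    have h5 := abs_add_le ((g.c - J * β) + (g'.c - β)) (g.a * g'.b)
    have h6 := abs_add_le (g.c - J * β) (g'.c - β)
    rw [h4]
    refine ⟨by linarith, by linarith, ?_⟩
    have : 0 ≤ (J : ℝ) * ρ ^ 2 := by positivity
    nlinarith [sq_nonneg ρ]

/-- The integer `k` is removed from the corner before measuring. Inversion adds `a b` to the corner,
which is then at most `4 C ^ 2 u = (2 C √u) ^ 2`; the 5 is 1 for the base and 2 for each gauge. -/
theorem norm_sub_le_of_regular {f : C(CircleHeis, ℂ)} {D : ℝ} (hD : 0 ≤ D)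
    (hf : IsRegularWith D f) (t s : UnitAddCircle) (y : HeisNil) (g : Heis) (k : ℤ) {u : ℝ}
    {C : ℝ} (hC : 1 ≤ C) (hu0 : 0 ≤ u) (hu1 : u ≤ 1) (hs : ‖s‖ ≤ u) (ha : |g.a| ≤ C * u)
    (hb : |g.b| ≤ C * u) (hc : |g.c - k| ≤ 3 * C ^ 2 * u) :
    ‖f (t + s, HeisNil.rmul y g) - f (t, y)‖ ≤ D * (5 * C * √u) := by
  set h : Heis := ⟨g.a, g.c - k, g.b⟩ with hh
  have hg : HeisNil.rmul y g = HeisNil.rmul y h := by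
    have : g = h * ⟨0, k, 0⟩ := by ext <;> simp [hh]
    rw [this, HeisNil.rmul_mul_central]
  have hsq : √u ^ 2 = u := Real.sq_sqrt hu0
  have hus : u ≤ √u := by
    have : √u ≤ 1 := Real.sqrt_le_one.2 hu1
    nlinarith [Real.sqrt_nonneg u]
  have hC0 : 0 ≤ C := by linarith
  have hCu : C * u ≤ 2 * C * √u := by nlinarith [Real.sqrt_nonneg u]
  have hC2 : 0 ≤ C ^ 2 * u := by positivity
  have hτ : (2 * C * √u) ^ 2 = 4 * (C ^ 2 * u) := by rw [mul_pow, hsq]; ring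
  have h1 : h.gauge ≤ 2 * C * √u := by
    refine Heis.gauge_le (by positivity) (ha.trans hCu) (hb.trans hCu) ?_
    rw [hτ]
    exact hc.trans (by linarith)
  have h2 : h⁻¹.gauge ≤ 2 * C * √u := by
    refine Heis.gauge_le (by positivity) ?_ ?_ ?_
    · rw [Heis.inv_a, abs_neg]; exact ha.trans hCu
    · rw [Heis.inv_b, abs_neg]; exact hb.trans hCu
    · rw [hτ, Heis.inv_c]
      have e1 : |h.a * h.b| ≤ C ^ 2 * u := by
        rw [abs_mul]
        calc |h.a| * |h.b| ≤ (C * u) * (C * u) := by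
              gcongr
          _ = C ^ 2 * u * u := by ring
          _ ≤ _ := mul_le_of_le_one_right hC2 hu1
      have e2 := abs_sub (h.a * h.b) h.c
      have e3 : |h.c| ≤ 3 * C ^ 2 * u := hc
      linarith
  rw [hg]
  refine (hf t s y h).trans ?_
  gcongr
  have : √u ≤ C * √u := le_mul_of_one_le_left (Real.sqrt_nonneg u) hC
  linarith

/-- The orbit `S ^ (j v q)` stays close to its starting point for `j ≤ q ^ (ε / 64)`. -/
theorem norm_iterate_sub_le {α ε C β : ℝ} {φ η ψ : C(UnitAddCircle, ℝ)} {q v : ℕ} {k : ℤ}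
    (hε : 0 < ε) (hε1 : ε < 1 / 100) (hq : 1 ≤ q) (hC : 1 ≤ C)
    (hqα : ‖q • (α : UnitAddCircle)‖ ≤ 1 / q)
    (h : ∀ t, |(iterCocycle (α : UnitAddCircle) φ η ψ q t).a| ≤ C * (q : ℝ) ^ (-(ε / 5)) ∧
      |(iterCocycle (α : UnitAddCircle) φ η ψ q t).b| ≤ C * (q : ℝ) ^ (-(ε / 5)) ∧
      |(iterCocycle (α : UnitAddCircle) φ η ψ q t).c - β| ≤ C * (q : ℝ) ^ (-(ε / 5)))
    (hv : (v : ℝ) ≤ (q : ℝ) ^ (ε / 16)) (hk : |v * β - k| ≤ (q : ℝ) ^ (-(ε / 16)))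
    {f : C(CircleHeis, ℂ)} {D : ℝ} (hD : 0 ≤ D) (hf : IsRegularWith D f) {j : ℕ}
    (hj : (j : ℝ) ≤ (q : ℝ) ^ (ε / 64)) (z : CircleHeis) :
    ‖f ((skewProduct α φ η ψ ^ (j * (v * q))) z) - f z‖ ≤
      D * (5 * C * √((q : ℝ) ^ (-(3 * ε / 64)))) := by
  obtain ⟨t, y⟩ := z
  have hq' : (1 : ℝ) ≤ q := by exact_mod_cast hq
  have hq0 : (0 : ℝ) < q := by linarith
  set x : UnitAddCircle := (α : UnitAddCircle)
  -- The exponent is that of the central error `j |v β - k|`, namely `ε/64 - ε/16`. The cocycle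
  -- error, of exponent `5ε/64 - ε/5`, is smaller.
  set u : ℝ := (q : ℝ) ^ (-(3 * ε / 64)) with hu
  have hu0 : 0 ≤ u := by positivity
  have hu1 : u ≤ 1 := Real.rpow_le_one_of_one_le_of_nonpos hq' (by linarith)
  have hle : ∀ {a b : ℝ}, a ≤ b → (q : ℝ) ^ a ≤ (q : ℝ) ^ b := fun hab =>
    Real.rpow_le_rpow_of_exponent_le hq' hab
  have hJ : ((j * v : ℕ) : ℝ) ≤ (q : ℝ) ^ (5 * ε / 64) := by
    push_cast
    calc (j : ℝ) * v ≤ (q : ℝ) ^ (ε / 64) * (q : ℝ) ^ (ε / 16) := by gcongr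
      _ = _ := by rw [← Real.rpow_add hq0]; congr 1; ring
  have hJρ : ((j * v : ℕ) : ℝ) * (C * (q : ℝ) ^ (-(ε / 5))) ≤ C * u := by
    calc ((j * v : ℕ) : ℝ) * (C * (q : ℝ) ^ (-(ε / 5)))
        ≤ (q : ℝ) ^ (5 * ε / 64) * (C * (q : ℝ) ^ (-(ε / 5))) := by gcongr
      _ = C * ((q : ℝ) ^ (5 * ε / 64) * (q : ℝ) ^ (-(ε / 5))) := by ring
      _ ≤ C * u := by
        rw [← Real.rpow_add hq0]
        gcongr ?_ * ?_
        exact hle (by linarith)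
  have hJs : ‖((j * v : ℕ) * q) • x‖ ≤ u := by
    rw [mul_smul]
    calc ‖(j * v : ℕ) • (q • x)‖ ≤ ((j * v : ℕ) : ℝ) * ‖q • x‖ := norm_nsmul_le
      _ ≤ (q : ℝ) ^ (5 * ε / 64) * (1 / q) := by gcongr
      _ = (q : ℝ) ^ (5 * ε / 64 + -1) := by
        rw [Real.rpow_add hq0, Real.rpow_neg_one, one_div]
      _ ≤ u := hle (by linarith)
  have hjk : |((j * v : ℕ) : ℝ) * β - ((j * k : ℤ) : ℝ)| ≤ u := by
    push_cast
    rw [show (j : ℝ) * v * β - j * k = j * (v * β - k) by ring, abs_mul, Nat.abs_cast]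
    calc (j : ℝ) * |v * β - k| ≤ (q : ℝ) ^ (ε / 64) * (q : ℝ) ^ (-(ε / 16)) := by gcongr
      _ = u := by rw [← Real.rpow_add hq0, hu]; congr 1; ring
  obtain ⟨ha, hb, hc⟩ := iterCocycle_mul_bound (by positivity) h (j * v) t
  rw [← mul_assoc, skewProduct_pow_apply]
  refine norm_sub_le_of_regular hD hf t _ y _ (j * k) hC hu0 hu1 hJs (ha.trans hJρ)
    (hb.trans hJρ) ?_
  have h1 : (((j * v : ℕ) : ℝ) * (C * (q : ℝ) ^ (-(ε / 5)))) ^ 2 ≤ (C * u) ^ 2 := by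
    gcongr
  have h2 := abs_sub_le ((iterCocycle x φ η ψ (j * v * q) t).c) (((j * v : ℕ) : ℝ) * β)
    ((j * k : ℤ) : ℝ)
  have h3 : (C * u) ^ 2 ≤ C ^ 2 * u := by
    rw [mul_pow]
    gcongr
    nlinarith
  have h4 : C * u ≤ C ^ 2 * u := by
    gcongr
    nlinarith
  have h5 : u ≤ C ^ 2 * u := le_mul_of_one_le_left hu0 (by nlinarith)
  linarith

/-! ### From uniform bounds to the rate of rigidity. -/

/-- The bound is uniform in the point, so negative `j` reduce to positive ones by evaluating at the
preimage. There are at most `2 M + 1 ≤ 3 M` values of `j`. -/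
theorem rigidityRate_of_bound {S : CircleHeis ≃ₜ CircleHeis} {ν : Measure CircleHeis}
    [IsProbabilityMeasure ν] {f : C(CircleHeis, ℂ)} {δ : ℝ} {r : ℕ → ℕ} {M B : ℕ → ℝ}
    (hM : ∀ n, ((r n : ℝ) ^ δ) ≤ M n) (hM1 : ∀ n, 1 ≤ M n)
    (hB : ∀ n (j : ℕ), (j : ℝ) ≤ M n → ∀ z, ‖f ((S ^ (j * r n)) z) - f z‖ ≤ B n)
    (hlim : Tendsto (fun n => 3 * M n * B n ^ 2) atTop (𝓝 0)) : RigidityRate S ν f δ r := by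
  refine squeeze_zero (fun n => Finset.sum_nonneg fun j _ => integral_nonneg fun z => by positivity)
    (fun n => ?_) hlim
  have hr0 : 0 ≤ (r n : ℝ) ^ δ := by positivity
  have hfl : (⌊(r n : ℝ) ^ δ⌋ : ℝ) ≤ M n := (Int.floor_le _).trans (hM n)
  have hfl0 : 0 ≤ ⌊(r n : ℝ) ^ δ⌋ := Int.floor_nonneg.2 hr0
  have key : ∀ j ∈ Finset.Icc (-⌊(r n : ℝ) ^ δ⌋) ⌊(r n : ℝ) ^ δ⌋,
      ∫ z, ‖f ((S ^ (j * (r n : ℤ))) z) - f z‖ ^ 2 ∂ν ≤ B n ^ 2 := by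
    intro j hj
    rw [Finset.mem_Icc] at hj
    have hpt : ∀ z, ‖f ((S ^ (j * (r n : ℤ))) z) - f z‖ ≤ B n := by
      intro z
      have hjM : ((j.natAbs : ℕ) : ℝ) ≤ M n := by
        refine le_trans ?_ hfl
        have : (j.natAbs : ℤ) ≤ ⌊(r n : ℝ) ^ δ⌋ := by omega
        have h' := (Int.cast_le (R := ℝ)).2 this
        rwa [Int.cast_natCast] at h'
      rcases Int.natAbs_eq j with h | h
      · have e : S ^ (j * (r n : ℤ)) = S ^ (j.natAbs * r n) := by
          rw [← zpow_natCast]; congr 1; push_cast; rw [← Int.natCast_natAbs, ← h]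
        rw [e]
        exact hB n _ hjM z
      · have e : S ^ (j * (r n : ℤ)) = (S ^ (j.natAbs * r n))⁻¹ := by
          rw [← zpow_natCast, ← zpow_neg]; congr 1; push_cast
          rw [← Int.natCast_natAbs, ← neg_mul, ← h]
        rw [e]
        have h1 := hB n _ hjM ((S ^ (j.natAbs * r n))⁻¹ z)
        rw [← Homeomorph.mul_apply, mul_inv_cancel, Homeomorph.one_apply, norm_sub_rev] at h1
        exact h1
    have h2 : ∀ z, ‖‖f ((S ^ (j * (r n : ℤ))) z) - f z‖ ^ 2‖ ≤ B n ^ 2 := fun z => by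
      rw [Real.norm_of_nonneg (by positivity)]
      exact pow_le_pow_left₀ (norm_nonneg _) (hpt z) 2
    have h3 := norm_integral_le_of_norm_le_const (μ := ν) (Eventually.of_forall h2)
    rw [probReal_univ, mul_one] at h3
    exact (le_abs_self _).trans h3
  calc _ ≤ ∑ j ∈ Finset.Icc (-⌊(r n : ℝ) ^ δ⌋) ⌊(r n : ℝ) ^ δ⌋, B n ^ 2 := Finset.sum_le_sum key
    _ = (2 * ⌊(r n : ℝ) ^ δ⌋ + 1) * B n ^ 2 := by
      rw [Finset.sum_const, nsmul_eq_mul, Int.card_Icc]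
      congr 1
      have : (((⌊(r n : ℝ) ^ δ⌋ + 1 - -⌊(r n : ℝ) ^ δ⌋).toNat : ℤ)) = 2 * ⌊(r n : ℝ) ^ δ⌋ + 1 := by
        omega
      exact_mod_cast congrArg (fun z : ℤ => (z : ℝ)) this
    _ ≤ 3 * M n * B n ^ 2 := by
      gcongr
      linarith [hM1 n]

/-- Dirichlet approximation with denominators up to `⌊q ^ a⌋`. -/
theorem exists_multiplier {β : ℝ} {q : ℕ} (hq : 1 ≤ q) {a : ℝ} (ha : 0 < a) :
    ∃ (v : ℕ) (k : ℤ), 1 ≤ v ∧ (v : ℝ) ≤ (q : ℝ) ^ a ∧ |v * β - k| ≤ (q : ℝ) ^ (-a) := by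
  have hq' : (1 : ℝ) ≤ q := by exact_mod_cast hq
  have h1 : 1 ≤ (q : ℝ) ^ a := Real.one_le_rpow hq' ha.le
  have hN : 0 < ⌊(q : ℝ) ^ a⌋₊ := Nat.floor_pos.2 h1
  obtain ⟨k, j, hj0, hjN, h⟩ := Real.exists_int_int_abs_mul_sub_le β hN
  have hj : ((j.toNat : ℕ) : ℤ) = j := Int.toNat_of_nonneg hj0.le
  have hjR : ((j.toNat : ℕ) : ℝ) = j := by exact_mod_cast congrArg (fun z : ℤ => (z : ℝ)) hj
  refine ⟨j.toNat, k, by omega, ?_, ?_⟩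
  · rw [hjR]
    have : (j : ℝ) ≤ ⌊(q : ℝ) ^ a⌋₊ := by exact_mod_cast hjN
    exact this.trans (Nat.floor_le (by positivity))
  · rw [hjR]
    refine h.trans ?_
    rw [Real.rpow_neg (by positivity), one_div]
    exact inv_anti₀ (by positivity) (Nat.lt_floor_add_one _).le

theorem theorem1p1 (α : ℝ) (hα : α ∈ Set.Ico (0 : ℝ) 1) (hirr : Irrational α)
    (ε : ℝ) (hε0 : 0 < ε) (hε1 : ε < 1 / 100) (φ η ψ : ℝ → ℝ)
    (hφ : IsSmoothPeriodic (2 + 2 * ε) φ) (hη : IsSmoothPeriodic (2 + 2 * ε) η)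
    (hψ : IsSmoothPeriodic (1 + ε) ψ)
    (hφ0 : ∫ t in (0 : ℝ)..1, φ t = 0) (hη0 : ∫ t in (0 : ℝ)..1, η t = 0)
    (S : CircleHeis ≃ₜ CircleHeis)
    (hS : S = skewProduct α (circleFun φ hφ.periodic hφ.continuous)
      (circleFun η hη.periodic hη.continuous) (circleFun ψ hψ.periodic hψ.continuous)) :
    (∀ ν : Measure CircleHeis, IsInvariantProb S ν → HasPRRigidity S ν) ∧
    ∃ (r m v : ℕ → ℕ), StrictMono m ∧ StrictMono r ∧
      (∀ n, 1 ≤ v n ∧ (v n : ℝ) ≤ (GenContFract.of α).dens (m n) ^ (ε / 16) ∧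
        (r n : ℝ) = v n * (GenContFract.of α).dens (m n)) ∧
      ∀ ν : Measure CircleHeis, IsInvariantProb S ν → HasPRRigidityAlong S ν r := by
  obtain ⟨cφ, Cφ, hFφ, hcφ⟩ := hφ.exists_hasFourierDecay (by linarith)
  obtain ⟨cη, Cη, hFη, hcη⟩ := hη.exists_hasFourierDecay (by linarith)
  obtain ⟨cψ, Cψ, hFψ, -⟩ := hψ.exists_hasFourierDecay (by linarith)
  rw [hφ0, Complex.ofReal_zero] at hcφ
  rw [hη0, Complex.ofReal_zero] at hcη
  obtain ⟨q, hqd, hqmono, hq1, hqtop, hqα, hqw⟩ := exists_denominators hirr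
  obtain ⟨C₀, hC₀, hfreq⟩ := frequently_headBound hqmono hq1 hqtop hqw hε0 (by linarith)
  obtain ⟨C, hC, hbound⟩ :=
    exists_cocycle_bound hε0 (by linarith) hFφ hFη hFψ hcφ hcη hC₀.le
  obtain ⟨m₁, hm₁, hgood⟩ := extraction_of_frequently_atTop hfreq
  have hβ := fun n => hbound _ (q (m₁ n)) (q (m₁ n + 1)) (hq1 _) (hqw _)
    (by have := hq1 (m₁ n + 1); positivity) (hqα _) (hgood n)
  choose β hβ using hβ
  choose v₁ k₁ hv1 hv2 hv3 using fun n =>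
    exists_multiplier (β := β n) (hq1 (m₁ n)) (show 0 < ε / 16 by linarith)
  have hqm : Tendsto (fun n => q (m₁ n)) atTop atTop := hqtop.comp hm₁.tendsto_atTop
  have htop : Tendsto (fun n => v₁ n * q (m₁ n)) atTop atTop :=
    tendsto_atTop_mono (fun n => Nat.le_mul_of_pos_left _ (hv1 n)) hqm
  -- The multipliers vary, so the products tend to infinity but need not increase; a subsequence
  -- does.
  obtain ⟨θ, hθ, hθr⟩ := strictMono_subseq_of_tendsto_atTop htop
  have hrig : ∀ ν : Measure CircleHeis, IsInvariantProb S ν →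
      HasPRRigidityAlong S ν (fun n => v₁ (θ n) * q (m₁ (θ n))) := by
    rintro ν ⟨hν, -⟩
    refine ⟨regularAlgebra, isLinearlyDense_regularAlgebra, ?_⟩
    rintro f ⟨D, hD, hf⟩
    -- Since `v ≤ q`, the rigidity time is at most `q ^ 2`, and its power `ε/128` is at most `q ^
    -- (ε/64)`.
    refine ⟨ε / 128, by linarith, ?_⟩
    refine rigidityRate_of_bound (M := fun n => (q (m₁ (θ n)) : ℝ) ^ (ε / 64))
      (B := fun n => D * (5 * C * √((q (m₁ (θ n)) : ℝ) ^ (-(3 * ε / 64))))) (fun n => ?_)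
      (fun n => ?_) (fun n j hj z => ?_) ?_
    · have h1 : (1 : ℝ) ≤ q (m₁ (θ n)) := by exact_mod_cast hq1 _
      have h2 : (v₁ (θ n) : ℝ) ≤ q (m₁ (θ n)) := by
        refine (hv2 _).trans ?_
        calc (q (m₁ (θ n)) : ℝ) ^ (ε / 16) ≤ (q (m₁ (θ n)) : ℝ) ^ (1 : ℝ) :=
              Real.rpow_le_rpow_of_exponent_le h1 (by linarith)
          _ = _ := Real.rpow_one _
      push_cast
      calc ((v₁ (θ n) : ℝ) * q (m₁ (θ n))) ^ (ε / 128)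
          ≤ ((q (m₁ (θ n)) : ℝ) * q (m₁ (θ n))) ^ (ε / 128) := by gcongr
        _ = _ := by
          rw [Real.mul_rpow (by positivity) (by positivity), ← Real.rpow_add (by positivity)]
          congr 1; ring
    · exact Real.one_le_rpow (by exact_mod_cast hq1 _) (by linarith)
    · rw [hS]
      refine norm_iterate_sub_le hε0 hε1 (hq1 _) hC ?_ (hβ (θ n)) (hv2 _) (hv3 _) hD hf hj z
      refine (hqα _).trans ?_
      have h1 : (1 : ℝ) ≤ q (m₁ (θ n)) := by exact_mod_cast hq1 _
      have h2 : (q (m₁ (θ n)) : ℝ) ≤ q (m₁ (θ n) + 1) := by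
        exact_mod_cast hqmono (Nat.le_succ _)
      gcongr
    · have h1 : Tendsto (fun n => (q (m₁ (θ n)) : ℝ)) atTop atTop :=
        tendsto_natCast_atTop_atTop.comp (hqm.comp hθ.tendsto_atTop)
      -- Here `3 M B ^ 2` equals `3 * 25 * D ^ 2 * C ^ 2` times `q` to the power `ε/64 - 3ε/64 =
      -- -ε/32`.
      have h2 := ((tendsto_rpow_neg_atTop (show 0 < ε / 32 by linarith)).comp h1).const_mul
        (75 * D ^ 2 * C ^ 2)
      rw [mul_zero] at h2
      refine h2.congr fun n => ?_
      have hq0 : (0 : ℝ) < q (m₁ (θ n)) := by exact_mod_cast hq1 _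
      have e : (q (m₁ (θ n)) : ℝ) ^ (-(ε / 32)) =
          (q (m₁ (θ n)) : ℝ) ^ (ε / 64) * (q (m₁ (θ n)) : ℝ) ^ (-(3 * ε / 64)) := by
        rw [← Real.rpow_add hq0]; congr 1; ring
      simp only [Function.comp_apply]
      rw [e, mul_pow, mul_pow, mul_pow, Real.sq_sqrt (by positivity)]
      ring
  refine ⟨fun ν hν => ?_, fun n => v₁ (θ n) * q (m₁ (θ n)), fun n => m₁ (θ n), fun n => v₁ (θ n),
    hm₁.comp hθ, hθr, fun n => ⟨hv1 _, ?_, ?_⟩, hrig⟩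
  · obtain ⟨F, hF, h⟩ := hrig ν hν
    refine ⟨F, hF, fun f hf => ?_⟩
    obtain ⟨δ, hδ, hr⟩ := h f hf
    exact ⟨δ, hδ, _, hθr, fun n => Nat.mul_pos (hv1 _) (hq1 _), hr⟩
  · rw [← hqd]; exact hv2 _
  · rw [← hqd]; push_cast; rfl
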